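/- **Setting.** Let $\mathbb H=\{z=x+iy: y>0\}$ with the hyperbolic metric $|dz|/y$, arclength $ds$, distance $d$, area $d\mu=y^{-2}\,dx\,dy$ and Laplacian $\Delta=-y^2(\partial_x^2+\partial_y^2)$. An eigenfunction with eigenvalue $\lambda>0$ on a closed region is a real- or complex-valued function $\psi$ that is $C^2$ up to the boundary and satisfies $\Delta\psi=\lambda\psi$ in the interior. Along a curve, $\partial_n\psi$ is the derivative of $\psi$ in the direction of the hyperbolic unit normal (taken from inside the region if the curve is its boundary). **Theorem 1.2.** (1) (Hyperbolic circles.) Let $w\in\mathbb H$, $R>0$, $\lambda>0$, let $B_R=\{z\in\mathbb H: d(z,w)\le R\}$ and let $\mathcal C_R$ be the hyperbolic circle bounding $B_R$. For every eigenfunction $\psi$ with eigenvalue $\lambda$ on $B_R$, $$\int_{\mathcal C_R}|\psi|^2\,ds+\frac1\lambda\int_{\mathcal C_R}|\partial_n\psi|^2\,ds\;\ge\;\frac{2}{\sinh R}\iint_{B_R}\cosh(r)\,|\psi|^2\,d\mu,\qquad r=d(z,w),$$ where the integral on the right converges. (2) (Closed horocycles.) Let $A>0$. A *cusp eigenfunction*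 with eigenvalue $\lambda$ is an eigenfunction $\psi$ on $\{y\ge A\}$ with $\psi(z+1)=\psi(z)$ whose square is integrable over $\{-\tfrac12<x\le\tfrac12,\ y\ge A\}$ with respect to $\mu$. For $Y\ge A$ let $\mathcal C_Y=\{x+iY:-\tfrac12<x\le\tfrac12\}$ and $\mathcal R_Y=\{-\tfrac12<x\le\tfrac12,\ y\ge Y\}$. For every $\lambda>0$, every cusp eigenfunction $\psi$ with eigenvalue $\lambda$, and every $Y\ge A$, $$\int_{\mathcal C_Y}|\psi|^2\,ds+\frac1\lambda\int_{\mathcal C_Y}|\partial_n\psi|^2\,ds\;\ge\;2Y\iint_{\mathcal R_Y}|\psi|^2\,y^{-1}\,d\mu,$$ where the integral on the right converges. (3) (Sharpness of the weight in (2).) Let $A>0$ and let $\alpha,G:[A,\infty)\to(0,\infty)$ be smooth functions with $\alpha(Y)G(y)\ge Y/y$ whenever $y\ge Y\ge A$. Suppose that for every $Y\ge A$, every $\lambda>0$ and every cusp eigenfunction $\psi$ with eigenvalue $\lambda$ that tends to $0$ as $y\to\infty$, uniformly in $x$, $$\int_{\mathcal C_Y}|\psi|^2\,ds+\frac1\lambda\int_{\mathcal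 C_Y}|\partial_n\psi|^2\,ds\;\ge\;2\alpha(Y)\iint_{\mathcal R_Y}|\psi|^2\,G(y)\,d\mu,$$ with a convergent integral on the right. Then $\alpha(Y)G(y)=Y/y$ for all $y\ge Y\ge A$. This holds both when only real-valued and when complex-valued $\psi$ are considered. -/

import Mathlib

open MeasureTheory UpperHalfPlane
open scoped ContDiff

noncomputable section

namespace HypRestriction

variable {𝕜 : Type*} [RCLike 𝕜]

/-- A function on the upper half-plane, read in the coordinate `z = x + i y`
(only its values at points with `y > 0` matter). -/
def inCoord (ψ : ℍ → 𝕜) : ℂ → 𝕜 := fun z => ψ (ofComplex z)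

/-- The (positive) hyperbolic Laplacian `Δ = -y² (∂²/∂x² + ∂²/∂y²)`. -/
def hypLaplacian (ψ : ℍ → 𝕜) (z : ℍ) : 𝕜 :=
  -((z.im ^ 2) • Laplacian.laplacian (inCoord ψ) (z : ℂ))

/-- `ψ` is an eigenfunction of the hyperbolic Laplacian with eigenvalue `lam` on the closed
region `S`: it is `C²` up to the boundary of `S`, and `Δ ψ = lam ψ` in the interior. -/
structure IsEigenfunctionOn (S : Set ℍ) (lam : ℝ) (ψ : ℍ → 𝕜) : Prop where
  contDiffOn : ContDiffOn ℝ 2 (inCoord ψ) (UpperHalfPlane.coe '' S)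
  eigen : ∀ z ∈ interior S, hypLaplacian ψ z = lam • ψ z

/-- The Euclidean velocity of a parametrized curve in the upper half-plane. -/
def velocity (γ : ℝ → ℍ) (t : ℝ) : ℂ := deriv (fun s => (γ s : ℂ)) t

/-- The integral of `f` over the curve `γ`, `a ≤ t ≤ b`, with respect to hyperbolic arclength
`ds = |dz| / y`; here `f` is a function of the parameter of the curve. -/
def arclengthIntegral (γ : ℝ → ℍ) (a b : ℝ) (f : ℝ → ℝ) : ℝ :=
  ∫ t in a..b, f t * (‖velocity γ t‖ / (γ t).im)

/-- The unit normal, for the hyperbolic metric, to the curve `γ`: the unit tangent rotated by a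
right angle, and of Euclidean length `y`. -/
def unitNormal (γ : ℝ → ℍ) (t : ℝ) : ℂ :=
  ((γ t).im : ℂ) * (Complex.I * (velocity γ t / (‖velocity γ t‖ : ℂ)))

/-- The hyperbolic unit normal derivative `∂ₙψ` along a curve `γ` in the closed region `S`
(the derivative taken from within `S` at points where `γ` runs in the boundary of `S`). -/
def normalDeriv (S : Set ℍ) (ψ : ℍ → 𝕜) (γ : ℝ → ℍ) (t : ℝ) : 𝕜 :=
  fderivWithin ℝ (inCoord ψ) (UpperHalfPlane.coe '' S) (γ t : ℂ) (unitNormal γ t)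

/-- The restricted norm `∫_C |ψ|² ds + lam⁻¹ ∫_C |∂ₙψ|² ds`, for the curve `C` given by
`γ` on `a ≤ t ≤ b`. -/
def restrictedNorm (S : Set ℍ) (lam : ℝ) (ψ : ℍ → 𝕜) (γ : ℝ → ℍ) (a b : ℝ) : ℝ :=
  arclengthIntegral γ a b (fun t => ‖ψ (γ t)‖ ^ 2) +
    lam⁻¹ * arclengthIntegral γ a b (fun t => ‖normalDeriv S ψ γ t‖ ^ 2)

/-! ### Hyperbolic circles -/

theorem polar_pos (r θ : ℝ) : 0 < Real.cosh r + Real.sinh r * Real.cos θ := by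
  have h1 := Real.cosh_sq r
  have h2 := Real.cosh_pos r
  have h3 := Real.neg_one_le_cos θ
  have h4 := Real.cos_le_one θ
  have h5 : |Real.sinh r * Real.cos θ| < Real.cosh r := by
    apply abs_lt_of_sq_lt_sq _ h2.le
    nlinarith [sq_nonneg (Real.sinh r), sq_nonneg (Real.cos θ),
      mul_nonneg (sq_nonneg (Real.sinh r)) (by nlinarith : (0 : ℝ) ≤ 1 - Real.cos θ ^ 2)]
  linarith [(abs_lt.mp h5).1]

/-- The point with geodesic polar coordinates `(r, θ)` about `w`. For `w = i` it is
`x + i y` with `x = sinh r sin θ / (cosh r + sinh r cos θ)`, `y = 1 / (cosh r + sinh r cos θ)`;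
the general case is its image under the isometry `z ↦ re w + (im w) z`, which takes `i` to `w`. -/
def polar (w : ℍ) (r θ : ℝ) : ℍ :=
  ⟨⟨w.re + w.im * (Real.sinh r * Real.sin θ / (Real.cosh r + Real.sinh r * Real.cos θ)),
    w.im * (1 / (Real.cosh r + Real.sinh r * Real.cos θ))⟩,
    mul_pos w.im_pos (one_div_pos.mpr (polar_pos r θ))⟩

/-- `polar w R θ` lies on the hyperbolic circle of radius `R` about `w`. -/
theorem dist_polar (w : ℍ) {R : ℝ} (hR : 0 ≤ R) (θ : ℝ) : dist (polar w R θ) w = R := by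
  have hp := polar_pos R θ
  have hw := w.im_pos
  have h := UpperHalfPlane.cosh_dist' (polar w R θ) w
  have h1 : (polar w R θ).re =
      w.re + w.im * (Real.sinh R * Real.sin θ / (Real.cosh R + Real.sinh R * Real.cos θ)) := rfl
  have h2 : (polar w R θ).im = w.im * (1 / (Real.cosh R + Real.sinh R * Real.cos θ)) := rfl
  have h3 : Real.cosh (dist (polar w R θ) w) = Real.cosh R := by
    rw [h, h1, h2]
    field_simp
    have e1 := Real.cosh_sq R
    have e2 := Real.sin_sq_add_cos_sq θ
    linear_combination (w.im ^ 2 * Real.sinh R ^ 2) * e2 - w.im ^ 2 * e1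
  rwa [← Real.cosh_abs, ← Real.cosh_abs R, Real.cosh_strictMonoOn.injOn.eq_iff
    (Set.mem_Ici.mpr (abs_nonneg _)) (Set.mem_Ici.mpr (abs_nonneg _)),
    abs_of_nonneg dist_nonneg, abs_of_nonneg hR] at h3

/-! ### Cusps and closed horocycles -/

/-- The closed region `y ≥ A`; its quotient by `z ↦ z + 1` is the cuspidal cylinder. -/
def cuspRegion (A : ℝ) : Set ℍ := {z | A ≤ z.im}

/-- The fundamental domain `-1/2 < x ≤ 1/2`, `y ≥ A` of the cuspidal cylinder. -/
def cuspStrip (A : ℝ) : Set ℍ := {z | -(1 / 2) < z.re ∧ z.re ≤ 1 / 2 ∧ A ≤ z.im}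

/-- The horocycle at height `Y`, `x ↦ x + i Y`; on `-1/2 ≤ x ≤ 1/2` it is the closed horocycle
of the cylinder. -/
def horocycle (Y : ℝ) (hY : 0 < Y) (x : ℝ) : ℍ := ⟨⟨x, Y⟩, hY⟩

/-- `ψ` is a square-integrable eigenfunction, with eigenvalue `lam`, on the cuspidal cylinder
`y ≥ A` (that is: of period `1` in `x`). -/
structure IsCuspEigenfunction (A lam : ℝ) (ψ : ℍ → 𝕜) : Prop where
  eigenfunction : IsEigenfunctionOn (cuspRegion A) lam ψ
  periodic : ∀ z ∈ cuspRegion A, ψ ((1 : ℝ) +ᵥ z) = ψ z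
  memLp : MemLp ψ 2 (volume.restrict (cuspStrip A))

end HypRestriction

end

/-!
Off its centre, resp. in its cusp, each region is a half-infinite cylinder: in a conformal
coordinate `ζ = θ + i s`, periodic in `θ`, the metric is `ρ(s) |dζ|`, with `ρ = 1 / s` for the cusp,
where `ζ = z`, and `ρ = 1 / sinh s` for the disc, where `z = re w + im w · tan (ζ / 2)`. There
`ψ_θθ + ψ_ss = -λ ρ² ψ`, and multiplying by `ψ_s` and integrating over `θ` gives Rellich's identity
`d/ds ∫ (|ψ_s|² + λ ρ² |ψ|² - |ψ_θ|²) dθ = λ (ρ²)' ∫ |ψ|² dθ`.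
The tangential energy `∫ |ψ_θ|² dθ` tends to `0` along some sequence going to the end of the
cylinder; integrating from the boundary `s = S` up to the end and discarding the tangential energy
at `S` gives both inequalities.

In the cusp, the only loss is thus the tangential energy on the horocycle. For
`ψ = √y K_{it}(2 π y) cos (2 π x)`, with `λ = 1/4 + t² → ∞`, this loss, divided by `λ`, is
negligible against the mass of `ψ` over any fixed interval `a ≤ y ≤ b`, so no weight can exceed
`Y / y` there.
-/

noncomputable section

namespace HypRestriction

open Set Filter Topology Pointwise

/-- The closed half-plane `im ζ ≥ S`: after quotienting by a horizontal translation, a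
half-infinite cylinder with boundary `im ζ = S`. -/
def closedHalfPlane (S : ℝ) : Set ℂ := {ζ | S ≤ ζ.im}

theorem closedHalfPlane_anti : Antitone closedHalfPlane := fun _ _ h _ hζ ↦ h.trans hζ

theorem interior_closedHalfPlane (S : ℝ) : interior (closedHalfPlane S) = {ζ | S < ζ.im} :=
  Complex.interior_setOfPred_le_im S

theorem mem_nhds_closedHalfPlane {S : ℝ} {ζ : ℂ} (hζ : S < ζ.im) : closedHalfPlane S ∈ 𝓝 ζ :=
  mem_interior_iff_mem_nhds.mp (by rwa [interior_closedHalfPlane])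

theorem uniqueDiffOn_closedHalfPlane (S : ℝ) : UniqueDiffOn ℝ (closedHalfPlane S) :=
  uniqueDiffOn_convex (convex_halfSpace_ge Complex.imLm.isLinear S)
    ⟨⟨0, S + 1⟩, by simp [interior_closedHalfPlane]⟩

/-- The integral of `h` over the cross-section `im ζ = s` of a cylinder of circumference `2 p`. -/
def slice (p : ℝ) (h : ℂ → ℝ) (s : ℝ) : ℝ := ∫ θ in -p..p, h ⟨θ, s⟩

section Slice

variable {p S : ℝ} {f g h : ℂ → ℝ}

theorem continuous_complexMk : Continuous fun x : ℝ × ℝ ↦ (⟨x.1, x.2⟩ : ℂ) :=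
  Complex.equivRealProdCLM.symm.continuous

theorem intervalIntegrable_slice (hh : ContinuousOn h (closedHalfPlane S)) {s : ℝ} (hs : S ≤ s)
    (a b : ℝ) : IntervalIntegrable (fun θ ↦ h ⟨θ, s⟩) volume a b :=
  (hh.comp_continuous (continuous_complexMk.comp (.prodMk_left s))
    fun _ ↦ hs).intervalIntegrable _ _

theorem slice_nonneg (hp : 0 ≤ p) {s : ℝ} (hh : ∀ θ, 0 ≤ h ⟨θ, s⟩) : 0 ≤ slice p h s :=
  intervalIntegral.integral_nonneg (by linarith) fun _ _ ↦ hh _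

theorem slice_mono (hp : 0 ≤ p) (hg : ContinuousOn g (closedHalfPlane S))
    (hh : ContinuousOn h (closedHalfPlane S)) {s : ℝ} (hs : S ≤ s)
    (hgh : ∀ θ, g ⟨θ, s⟩ ≤ h ⟨θ, s⟩) : slice p g s ≤ slice p h s :=
  intervalIntegral.integral_mono_on (by linarith) (intervalIntegrable_slice hg hs _ _)
    (intervalIntegrable_slice hh hs _ _) fun θ _ ↦ hgh θ

theorem slice_sub (hg : ContinuousOn g (closedHalfPlane S))
    (hh : ContinuousOn h (closedHalfPlane S)) {s : ℝ} (hs : S ≤ s) :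
    slice p (fun ζ ↦ g ζ - h ζ) s = slice p g s - slice p h s :=
  intervalIntegral.integral_sub (intervalIntegrable_slice hg hs _ _)
    (intervalIntegrable_slice hh hs _ _)

theorem slice_const_mul (c : ℝ) (h : ℂ → ℝ) (s : ℝ) :
    slice p (fun ζ ↦ c * h ζ) s = c * slice p h s :=
  intervalIntegral.integral_const_mul c _

theorem continuousOn_slice (hh : ContinuousOn h (closedHalfPlane S)) :
    ContinuousOn (slice p h) (Ici S) := by
  have hmax : Continuous (Function.uncurry fun s θ : ℝ ↦ h ⟨θ, max S s⟩) :=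
    hh.comp_continuous (continuous_complexMk.comp (by fun_prop : Continuous fun x : ℝ × ℝ ↦
      (x.2, max S x.1))) fun x ↦ le_max_left S x.1
  refine (intervalIntegral.continuous_parametric_intervalIntegral_of_continuous' (μ := volume)
    hmax (-p) p).continuousOn.congr fun s hs ↦ ?_
  simp only [slice, max_eq_right (mem_Ici.mp hs)]

theorem intervalIntegrable_slice_height (hh : ContinuousOn h (closedHalfPlane S)) {a b : ℝ}
    (ha : S ≤ a) (hab : a ≤ b) : IntervalIntegrable (slice p h) volume a b :=
  ((continuousOn_slice hh).mono fun _ hs ↦ ha.trans (by rw [uIcc_of_le hab] at hs; exact hs.1)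
    ).intervalIntegrable

/-- The real-linear isomorphism `(s, θ) ↦ θ + i s`. -/
def cylinderCoord : (ℝ × ℝ) ≃L[ℝ] ℂ :=
  (ContinuousLinearEquiv.prodComm ℝ ℝ ℝ).trans Complex.equivRealProdCLM.symm

/-- The divergence theorem on a piece of a cylinder: periodicity cancels the vertical sides. -/
theorem slice_sub_slice {f' g' : ℂ → ℂ →L[ℝ] ℝ} (hf : ContinuousOn f (closedHalfPlane S))
    (hg : ContinuousOn g (closedHalfPlane S)) (hh : ContinuousOn h (closedHalfPlane S))
    (hf' : ∀ ζ, S < ζ.im → HasFDerivAt f (f' ζ) ζ) (hg' : ∀ ζ, S < ζ.im → HasFDerivAt g (g' ζ) ζ)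
    (hdiv : ∀ ζ, S < ζ.im → f' ζ Complex.I + g' ζ 1 = h ζ)
    (hper : ∀ ζ, S ≤ ζ.im → g (ζ + (2 * p : ℝ)) = g ζ) {a b : ℝ} (ha : S ≤ a) (hab : a ≤ b) :
    slice p f b - slice p f a = ∫ s in a..b, slice p h s := by
  classical
  let e := cylinderCoord
  let D (x : ℝ × ℝ) : ℝ × ℝ →L[ℝ] ℝ :=
    if S < x.1 then f' (e x) ∘L e else h (e x) • ContinuousLinearMap.fst ℝ ℝ ℝ
  let D' (x : ℝ × ℝ) : ℝ × ℝ →L[ℝ] ℝ := if S < x.1 then g' (e x) ∘L e else 0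
  have hD (x : ℝ × ℝ) : D x (1, 0) + D' x (0, 1) = h (e x) := by
    by_cases hx : S < x.1
    · simpa [D, D', hx] using! hdiv (e x) hx
    · simp [D, D', hx]
  have hmaps : MapsTo e (uIcc a b ×ˢ uIcc (-p) p) (closedHalfPlane S) := fun x hx ↦
    ha.trans (by rw [uIcc_of_le hab] at hx; exact hx.1.1)
  have hcont {k : ℂ → ℝ} (hk : ContinuousOn k (closedHalfPlane S)) :
      ContinuousOn (k ∘ e) (uIcc a b ×ˢ uIcc (-p) p) := hk.comp e.continuous.continuousOn hmaps
  have hinside {x : ℝ × ℝ} (hx : x ∈ Ioo (min a b) (max a b) ×ˢ Ioo (min (-p) p) (max (-p) p)) :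
      S < x.1 := ha.trans_lt (by rw [min_eq_left hab] at hx; exact hx.1.1)
  have key := integral2_divergence_prod_of_hasFDerivAt (f ∘ e) (g ∘ e) D D' a (-p) b p
    (hcont hf) (hcont hg)
    (fun x hx ↦ by
      simpa only [D, hinside hx, if_true] using (hf' (e x) (hinside hx)).comp x e.hasFDerivAt)
    (fun x hx ↦ by
      simpa only [D', hinside hx, if_true] using (hg' (e x) (hinside hx)).comp x e.hasFDerivAt)
    (by
      simp only [hD]
      exact (hcont hh).integrableOn_compact (isCompact_uIcc.prod isCompact_uIcc))
  have hsides : ∫ s in a..b, (g ∘ e) (s, p) = ∫ s in a..b, (g ∘ e) (s, -p) := by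
    refine intervalIntegral.integral_congr fun s hs ↦ ?_
    rw [uIcc_of_le hab] at hs
    have := hper ⟨-p, s⟩ (ha.trans hs.1)
    rwa [show (⟨-p, s⟩ + (2 * p : ℝ) : ℂ) = ⟨p, s⟩ by apply Complex.ext <;> simp; ring] at this
  simp only [hD] at key
  rw [hsides, sub_self, zero_add] at key
  exact key.symm

/-- A fundamental domain for the part of the cylinder of circumference `2 p` above height `S`. -/
def halfCylinder (p S : ℝ) : Set ℂ := Ioc (-p) p ×ℂ Ici S

theorem halfCylinder_subset (p S : ℝ) : halfCylinder p S ⊆ closedHalfPlane S := fun _ hζ ↦ hζ.2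

theorem measurableSet_halfCylinder (p S : ℝ) : MeasurableSet (halfCylinder p S) :=
  (Complex.measurable_re measurableSet_Ioc).inter (Complex.measurable_im measurableSet_Ici)

theorem integrableOn_reProdIm (hh : ContinuousOn h (closedHalfPlane S)) (T : ℝ) :
    IntegrableOn h (Ioc (-p) p ×ℂ Icc S T) :=
  ((hh.mono fun _ hζ ↦ hζ.2.1).integrableOn_compact (isCompact_Icc.reProdIm isCompact_Icc)).mono_set
    (t := Icc (-p) p ×ℂ Icc S T) fun _ hζ ↦ ⟨Ioc_subset_Icc_self hζ.1, hζ.2⟩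

theorem setIntegral_reProdIm_eq (hp : 0 ≤ p) (hh : ContinuousOn h (closedHalfPlane S)) {T : ℝ}
    (hT : S ≤ T) : ∫ ζ in Ioc (-p) p ×ℂ Icc S T, h ζ = ∫ s in S..T, slice p h s := by
  have hmp := Complex.volume_preserving_equiv_real_prod.symm
  have hemb := Complex.measurableEquivRealProd.symm.measurableEmbedding
  have hpre : Complex.measurableEquivRealProd.symm ⁻¹' (Ioc (-p) p ×ℂ Icc S T) =
      Ioc (-p) p ×ˢ Icc S T := rfl
  have hint := (hmp.integrableOn_comp_preimage hemb).mpr (integrableOn_reProdIm (p := p) hh T)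
  rw [hpre, Measure.volume_eq_prod] at hint
  rw [← hmp.setIntegral_preimage_emb hemb, hpre, Measure.volume_eq_prod,
    ← setIntegral_prod_swap, setIntegral_prod (fun x : ℝ × ℝ ↦
      h (Complex.measurableEquivRealProd.symm x.swap)) hint.swap, integral_Icc_eq_integral_Ioc,
    ← intervalIntegral.integral_of_le hT]
  simp only [slice, intervalIntegral.integral_of_le (neg_le_self hp)]
  rfl

theorem aecover_halfCylinder (p S : ℝ) :
    AECover (volume.restrict (halfCylinder p S)) atTop fun T : ℝ ↦ Ioc (-p) p ×ℂ Icc S T where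
  ae_eventually_mem := by
    filter_upwards [ae_restrict_mem (measurableSet_halfCylinder p S)] with ζ hζ
    filter_upwards [eventually_ge_atTop ζ.im] with T hT using ⟨hζ.1, hζ.2, hT⟩
  measurableSet T :=
    (Complex.measurable_re measurableSet_Ioc).inter (Complex.measurable_im measurableSet_Icc)

theorem restrict_halfCylinder_restrict (p S T : ℝ) :
    (volume.restrict (halfCylinder p S)).restrict (Ioc (-p) p ×ℂ Icc S T) =
      volume.restrict (Ioc (-p) p ×ℂ Icc S T) :=
  Measure.restrict_restrict_of_subset fun _ hζ ↦ ⟨hζ.1, hζ.2.1⟩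

theorem integrableOn_and_setIntegral_halfCylinder_le (hp : 0 ≤ p)
    (hh : ContinuousOn h (closedHalfPlane S)) (hpos : ∀ ζ ∈ closedHalfPlane S, 0 ≤ h ζ) {C : ℝ}
    (hC : ∀ T, S ≤ T → ∫ s in S..T, slice p h s ≤ C) :
    IntegrableOn h (halfCylinder p S) ∧ ∫ ζ in halfCylinder p S, h ζ ≤ C := by
  have hcover := aecover_halfCylinder p S
  have hpiece {T : ℝ} : ∫ ζ in Ioc (-p) p ×ℂ Icc S T, h ζ ∂volume.restrict (halfCylinder p S) =
      ∫ ζ in Ioc (-p) p ×ℂ Icc S T, h ζ := by rw [restrict_halfCylinder_restrict]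
  have hbound : ∀ᶠ T in atTop,
      ∫ ζ in Ioc (-p) p ×ℂ Icc S T, h ζ ∂volume.restrict (halfCylinder p S) ≤ C := by
    filter_upwards [eventually_ge_atTop S] with T hT
    rw [hpiece, setIntegral_reProdIm_eq hp hh hT]
    exact hC T hT
  have hae : 0 ≤ᵐ[volume.restrict (halfCylinder p S)] h :=
    (ae_restrict_iff' (measurableSet_halfCylinder p S)).mpr
      (.of_forall fun ζ hζ ↦ hpos ζ (halfCylinder_subset p S hζ))
  have hint : IntegrableOn h (halfCylinder p S) :=
    hcover.integrable_of_integral_bounded_of_nonneg_ae C (fun T ↦ by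
      rw [IntegrableOn, restrict_halfCylinder_restrict]
      exact integrableOn_reProdIm hh T) hae hbound
  exact ⟨hint, le_of_tendsto (hcover.integral_tendsto_of_countably_generated hint) hbound⟩

theorem integral_slice_le (hp : 0 ≤ p) (hh : ContinuousOn h (closedHalfPlane S))
    (hpos : ∀ ζ ∈ closedHalfPlane S, 0 ≤ h ζ) (hint : IntegrableOn h (halfCylinder p S)) {a b : ℝ}
    (ha : S ≤ a) (hab : a ≤ b) : ∫ s in a..b, slice p h s ≤ ∫ ζ in halfCylinder p S, h ζ := by
  rw [← setIntegral_reProdIm_eq hp (hh.mono (closedHalfPlane_anti ha)) hab]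
  exact setIntegral_mono_set hint
    ((ae_restrict_iff' (measurableSet_halfCylinder p S)).mpr
      (.of_forall fun ζ hζ ↦ hpos ζ (halfCylinder_subset p S hζ)))
    (.of_forall fun _ hζ ↦ ⟨hζ.1, ha.trans hζ.2.1⟩)

end Slice

section SecondDerivative

variable {F : Type*} [NormedAddCommGroup F] [NormedSpace ℝ F] {φ : ℂ → F} {K : Set ℂ} {z : ℂ}

theorem hasFDerivAt_fderivWithin (h : ContDiffOn ℝ 2 φ K) (hz : z ∈ interior K) :
    HasFDerivAt φ (fderivWithin ℝ φ K z) z := by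
  have hK := mem_interior_iff_mem_nhds.mp hz
  rw [fderivWithin_of_mem_nhds hK]
  exact ((h.contDiffAt hK).differentiableAt two_ne_zero).hasFDerivAt

theorem hasFDerivAt_fderivWithin_fderiv (h : ContDiffOn ℝ 2 φ K) (hz : z ∈ interior K) :
    HasFDerivAt (fderivWithin ℝ φ K) (fderiv ℝ (fderiv ℝ φ) z) z := by
  have hfderiv : ContDiffAt ℝ 1 (fderiv ℝ φ) z :=
    (h.contDiffAt (mem_interior_iff_mem_nhds.mp hz)).fderiv_right one_add_one_eq_two.le
  refine (hfderiv.differentiableAt one_ne_zero).hasFDerivAt.congr_of_eventuallyEq ?_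
  filter_upwards [isOpen_interior.mem_nhds hz] with y hy
  exact fderivWithin_of_mem_nhds (mem_interior_iff_mem_nhds.mp hy)

theorem laplacian_eq_fderiv_fderiv (φ : ℂ → F) (z : ℂ) : Laplacian.laplacian φ z =
    fderiv ℝ (fderiv ℝ φ) z 1 1 + fderiv ℝ (fderiv ℝ φ) z Complex.I Complex.I := by
  simp [InnerProductSpace.laplacian_eq_iteratedFDeriv_complexPlane, iteratedFDeriv_two_apply]

end SecondDerivative

variable {F : Type*} [NormedAddCommGroup F] [InnerProductSpace ℝ F]

/-- Solutions `u` of `Δ u + κ(im ζ) u = 0` on the half-infinite cylinder of circumference `2 p`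
with boundary `im ζ = S`, lifted to a half-plane; here `Δ = ∂²/∂θ² + ∂²/∂s²` for `ζ = θ + i s`. -/
structure IsCylinderSolution (p S : ℝ) (κ : ℝ → ℝ) (u : ℂ → F) : Prop where
  contDiffOn : ContDiffOn ℝ 2 u (closedHalfPlane S)
  laplacian_eq : ∀ ζ : ℂ, S < ζ.im → Laplacian.laplacian u ζ = -(κ ζ.im • u ζ)
  periodic : ∀ ζ ∈ closedHalfPlane S, u (ζ + (2 * p : ℝ)) = u ζ

/-- The derivative of `u` in the direction `v`, taken within the half-plane `im ζ ≥ S`. For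
`ζ = θ + i s`, the directions `v = 1` and `v = i` give `∂u/∂θ` and `∂u/∂s`. -/
def partialDeriv (S : ℝ) (u : ℂ → F) (v ζ : ℂ) : F := fderivWithin ℝ u (closedHalfPlane S) ζ v

namespace IsCylinderSolution

variable {p S : ℝ} {κ κ' : ℝ → ℝ} {u : ℂ → F}

theorem continuousOn_partialDeriv (hu : IsCylinderSolution p S κ u) (v : ℂ) :
    ContinuousOn (partialDeriv S u v) (closedHalfPlane S) :=
  (hu.contDiffOn.continuousOn_fderivWithin (uniqueDiffOn_closedHalfPlane S) one_le_two).clm_apply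
    continuousOn_const

theorem continuousOn_norm_sq_partialDeriv (hu : IsCylinderSolution p S κ u) (v : ℂ) :
    ContinuousOn (fun ζ ↦ ‖partialDeriv S u v ζ‖ ^ 2) (closedHalfPlane S) :=
  (hu.continuousOn_partialDeriv v).norm.pow 2

theorem continuousOn_mul_norm_sq (hu : IsCylinderSolution p S κ u) {k : ℝ → ℝ}
    (hk : ContinuousOn k (Ici S)) :
    ContinuousOn (fun ζ ↦ k ζ.im * ‖u ζ‖ ^ 2) (closedHalfPlane S) :=
  (hk.comp Complex.continuous_im.continuousOn fun _ hζ ↦ hζ).mul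
    (hu.contDiffOn.continuousOn.norm.pow 2)

theorem continuousOn_inner_partialDeriv (hu : IsCylinderSolution p S κ u) (v : ℂ) :
    ContinuousOn (fun ζ ↦ 2 * inner ℝ (u ζ) (partialDeriv S u v ζ)) (closedHalfPlane S) :=
  (hu.contDiffOn.continuousOn.inner (𝕜 := ℝ) (hu.continuousOn_partialDeriv v)).const_mul 2

theorem hasFDerivAt (hu : IsCylinderSolution p S κ u) {ζ : ℂ} (hζ : S < ζ.im) :
    HasFDerivAt u (fderivWithin ℝ u (closedHalfPlane S) ζ) ζ :=
  hasFDerivAt_fderivWithin hu.contDiffOn (by rwa [interior_closedHalfPlane])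

theorem hasFDerivAt_partialDeriv (hu : IsCylinderSolution p S κ u) (v : ℂ) {ζ : ℂ}
    (hζ : S < ζ.im) :
    HasFDerivAt (partialDeriv S u v) ((fderiv ℝ (fderiv ℝ u) ζ).flip v) ζ := by
  simpa using! (hasFDerivAt_fderivWithin_fderiv hu.contDiffOn
    (by rwa [interior_closedHalfPlane])).clm_apply (hasFDerivAt_const v ζ)

theorem fderiv_fderiv_comm (hu : IsCylinderSolution p S κ u) {ζ : ℂ} (hζ : S < ζ.im) (v w : ℂ) :
    fderiv ℝ (fderiv ℝ u) ζ v w = fderiv ℝ (fderiv ℝ u) ζ w v :=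
  ((hu.contDiffOn.contDiffAt (mem_nhds_closedHalfPlane hζ)).isSymmSndFDerivAt (by simp)).eq v w

theorem partialDeriv_periodic (hu : IsCylinderSolution p S κ u) (v : ℂ) {ζ : ℂ}
    (hζ : S ≤ ζ.im) :
    partialDeriv S u v (ζ + (2 * p : ℝ)) = partialDeriv S u v ζ := by
  have hshift : ((2 * p : ℝ) : ℂ) +ᵥ closedHalfPlane S = closedHalfPlane S := by
    ext ζ
    simp [mem_vadd_set_iff_neg_vadd_mem, closedHalfPlane]
  have hcongr : fderivWithin ℝ (fun ζ ↦ u (ζ + (2 * p : ℝ))) (closedHalfPlane S) ζ =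
      fderivWithin ℝ u (closedHalfPlane S) ζ :=
    fderivWithin_congr hu.periodic (hu.periodic ζ hζ)
  rw [fderivWithin_comp_add_right, hshift] at hcongr
  rw [partialDeriv, hcongr, partialDeriv]

theorem inner_fderiv_fderiv (hu : IsCylinderSolution p S κ u) {ζ : ℂ} (hζ : S < ζ.im) (x : F) :
    inner ℝ x (fderiv ℝ (fderiv ℝ u) ζ 1 1) +
      inner ℝ x (fderiv ℝ (fderiv ℝ u) ζ Complex.I Complex.I) = -(κ ζ.im * inner ℝ x (u ζ)) := by
  rw [← inner_add_right, ← laplacian_eq_fderiv_fderiv, hu.laplacian_eq ζ hζ, inner_neg_right,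
    real_inner_smul_right]

theorem rellich_identity (hu : IsCylinderSolution p S κ u)
    (hκ : ∀ s, S ≤ s → HasDerivAt κ (κ' s) s) (hκ' : ContinuousOn κ' (Ici S)) {a b : ℝ}
    (ha : S ≤ a) (hab : a ≤ b) :
    slice p (fun ζ ↦ ‖partialDeriv S u Complex.I ζ‖ ^ 2 + κ ζ.im * ‖u ζ‖ ^ 2 -
        ‖partialDeriv S u 1 ζ‖ ^ 2) b -
      slice p (fun ζ ↦ ‖partialDeriv S u Complex.I ζ‖ ^ 2 + κ ζ.im * ‖u ζ‖ ^ 2 -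
        ‖partialDeriv S u 1 ζ‖ ^ 2) a =
      ∫ s in a..b, slice p (fun ζ ↦ κ' ζ.im * ‖u ζ‖ ^ 2) s := by
  refine slice_sub_slice (g := fun ζ ↦
      2 * inner ℝ (partialDeriv S u Complex.I ζ) (partialDeriv S u 1 ζ))
    (((hu.continuousOn_norm_sq_partialDeriv _).add (hu.continuousOn_mul_norm_sq fun s hs ↦
      (hκ s hs).continuousAt.continuousWithinAt)).sub (hu.continuousOn_norm_sq_partialDeriv _))
    (((hu.continuousOn_partialDeriv _).inner (𝕜 := ℝ)
      (hu.continuousOn_partialDeriv _)).const_mul 2) (hu.continuousOn_mul_norm_sq hκ')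
    (fun ζ hζ ↦ ((hu.hasFDerivAt_partialDeriv _ hζ).norm_sq.add
      (((hκ ζ.im hζ.le).comp_hasFDerivAt ζ Complex.imCLM.hasFDerivAt).mul
        (hu.hasFDerivAt hζ).norm_sq)).sub (hu.hasFDerivAt_partialDeriv _ hζ).norm_sq)
    (fun ζ hζ ↦ ((hu.hasFDerivAt_partialDeriv _ hζ).inner ℝ
      (hu.hasFDerivAt_partialDeriv _ hζ)).const_mul 2)
    (fun ζ hζ ↦ ?_) (fun ζ hζ ↦ by simp only [hu.partialDeriv_periodic _ hζ]) ha hab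
  have heq := hu.inner_fderiv_fderiv hζ (partialDeriv S u Complex.I ζ)
  have hsymm := hu.fderiv_fderiv_comm hζ Complex.I 1
  have hcomm := real_inner_comm (partialDeriv S u Complex.I ζ) (u ζ)
  have hcomm' := real_inner_comm (partialDeriv S u 1 ζ) (fderiv ℝ (fderiv ℝ u) ζ 1 Complex.I)
  simp only [fderivInnerCLM_apply, ContinuousLinearMap.flip_apply, innerSL_apply_apply, hsymm,
    add_apply, sub_apply, smul_apply, ContinuousLinearMap.comp_apply,
    ContinuousLinearMap.prod_apply, smul_eq_mul, nsmul_eq_mul, Function.comp_apply,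
    Complex.imCLM_apply, Complex.I_im]
  simp only [partialDeriv] at *
  push_cast
  linear_combination 2 * heq + 2 * κ ζ.im * hcomm + 2 * hcomm'

theorem slice_norm_sq_sub (hu : IsCylinderSolution p S κ u) {a b : ℝ} (ha : S ≤ a) (hab : a ≤ b) :
    slice p (fun ζ ↦ ‖u ζ‖ ^ 2) b - slice p (fun ζ ↦ ‖u ζ‖ ^ 2) a =
      ∫ s in a..b, slice p (fun ζ ↦ 2 * inner ℝ (u ζ) (partialDeriv S u Complex.I ζ)) s :=
  slice_sub_slice (g := 0) (g' := 0) (hu.contDiffOn.continuousOn.norm.pow 2) continuousOn_const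
    (hu.continuousOn_inner_partialDeriv _)
    (fun ζ hζ ↦ (hu.hasFDerivAt hζ).norm_sq) (fun _ _ ↦ hasFDerivAt_const 0 _)
    (fun ζ _ ↦ by simp [partialDeriv]) (fun _ _ ↦ rfl) ha hab

theorem slice_inner_sub (hu : IsCylinderSolution p S κ u) (hκ : ContinuousOn κ (Ici S)) {a b : ℝ}
    (ha : S ≤ a) (hab : a ≤ b) :
    slice p (fun ζ ↦ 2 * inner ℝ (u ζ) (partialDeriv S u Complex.I ζ)) b -
      slice p (fun ζ ↦ 2 * inner ℝ (u ζ) (partialDeriv S u Complex.I ζ)) a =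
      ∫ s in a..b, slice p (fun ζ ↦ 2 * (‖partialDeriv S u 1 ζ‖ ^ 2 +
        ‖partialDeriv S u Complex.I ζ‖ ^ 2 - κ ζ.im * ‖u ζ‖ ^ 2)) s := by
  refine slice_sub_slice (g := fun ζ ↦ 2 * inner ℝ (u ζ) (partialDeriv S u 1 ζ))
    (h := fun ζ ↦ 2 * (‖partialDeriv S u 1 ζ‖ ^ 2 + ‖partialDeriv S u Complex.I ζ‖ ^ 2 -
      κ ζ.im * ‖u ζ‖ ^ 2))
    (hu.continuousOn_inner_partialDeriv _) (hu.continuousOn_inner_partialDeriv _)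
    ((((hu.continuousOn_norm_sq_partialDeriv _).add (hu.continuousOn_norm_sq_partialDeriv _)).sub
      (hu.continuousOn_mul_norm_sq hκ)).const_mul 2)
    (fun ζ hζ ↦ ((hu.hasFDerivAt hζ).inner ℝ (hu.hasFDerivAt_partialDeriv _ hζ)).const_mul 2)
    (fun ζ hζ ↦ ((hu.hasFDerivAt hζ).inner ℝ (hu.hasFDerivAt_partialDeriv _ hζ)).const_mul 2)
    (fun ζ hζ ↦ ?_)
    (fun ζ hζ ↦ by simp only [hu.periodic ζ hζ, hu.partialDeriv_periodic _ hζ]) ha hab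
  have heq := hu.inner_fderiv_fderiv hζ (u ζ)
  simp only [fderivInnerCLM_apply, ContinuousLinearMap.flip_apply, smul_apply,
    ContinuousLinearMap.comp_apply, ContinuousLinearMap.prod_apply, smul_eq_mul, partialDeriv,
    real_inner_self_eq_norm_sq] at heq ⊢
  linear_combination 2 * heq

theorem setIntegral_neg_deriv_mul_norm_sq_le (hu : IsCylinderSolution p S κ u) (hp : 0 ≤ p)
    (hκ : ∀ s, S ≤ s → HasDerivAt κ (κ' s) s) (hκ' : ContinuousOn κ' (Ici S))
    (hκ_nonneg : ∀ s, S ≤ s → 0 ≤ κ s) (hκ'_nonpos : ∀ s, S ≤ s → κ' s ≤ 0)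
    (htan : ∀ ε > 0, ∃ᶠ T in atTop, slice p (fun ζ ↦ ‖partialDeriv S u 1 ζ‖ ^ 2) T < ε)
    {Y : ℝ} (hY : S ≤ Y) :
    IntegrableOn (fun ζ ↦ -κ' ζ.im * ‖u ζ‖ ^ 2) (halfCylinder p Y) ∧
      ∫ ζ in halfCylinder p Y, -κ' ζ.im * ‖u ζ‖ ^ 2 ≤
        slice p (fun ζ ↦ ‖partialDeriv S u Complex.I ζ‖ ^ 2 + κ ζ.im * ‖u ζ‖ ^ 2) Y := by
  have hh : ContinuousOn (fun ζ ↦ -κ' ζ.im * ‖u ζ‖ ^ 2) (closedHalfPlane S) :=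
    hu.continuousOn_mul_norm_sq hκ'.neg
  have hpos : ∀ ζ ∈ closedHalfPlane S, 0 ≤ -κ' ζ.im * ‖u ζ‖ ^ 2 := fun ζ hζ ↦
    mul_nonneg (neg_nonneg.mpr (hκ'_nonpos _ hζ)) (by positivity)
  have hf : ContinuousOn (fun ζ ↦ ‖partialDeriv S u Complex.I ζ‖ ^ 2 + κ ζ.im * ‖u ζ‖ ^ 2)
      (closedHalfPlane S) := (hu.continuousOn_norm_sq_partialDeriv _).add
    (hu.continuousOn_mul_norm_sq fun s hs ↦ (hκ s hs).continuousAt.continuousWithinAt)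
  have ht := hu.continuousOn_norm_sq_partialDeriv 1
  have hsub := closedHalfPlane_anti hY
  refine integrableOn_and_setIntegral_halfCylinder_le hp (hh.mono hsub)
    (fun ζ hζ ↦ hpos ζ (hsub hζ)) fun T hT ↦ le_of_forall_pos_le_add fun ε hε ↦ ?_
  obtain ⟨T', hTT', hε'⟩ := (htan ε hε).forall_exists_of_atTop T
  have hYT' := hT.trans hTT'
  have hident := hu.rellich_identity hκ hκ' hY hYT'
  rw [slice_sub hf ht hY, slice_sub hf ht (hY.trans hYT')] at hident
  have hneg : ∫ s in Y..T', slice p (fun ζ ↦ -κ' ζ.im * ‖u ζ‖ ^ 2) s =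
      -∫ s in Y..T', slice p (fun ζ ↦ κ' ζ.im * ‖u ζ‖ ^ 2) s := by
    simp only [slice, neg_mul, intervalIntegral.integral_neg]
  have hmono : ∫ s in Y..T, slice p (fun ζ ↦ -κ' ζ.im * ‖u ζ‖ ^ 2) s ≤
      ∫ s in Y..T', slice p (fun ζ ↦ -κ' ζ.im * ‖u ζ‖ ^ 2) s :=
    intervalIntegral.integral_mono_interval le_rfl hT hTT'
      ((ae_restrict_iff' measurableSet_Ioc).mpr (.of_forall fun s hs ↦
        slice_nonneg hp fun θ ↦ hpos _ (hY.trans hs.1.le)))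
      (intervalIntegrable_slice_height hh hY hYT')
  have hfT' : 0 ≤ slice p (fun ζ ↦ ‖partialDeriv S u Complex.I ζ‖ ^ 2 + κ ζ.im * ‖u ζ‖ ^ 2) T' :=
    slice_nonneg hp fun θ ↦ add_nonneg (by positivity)
      (mul_nonneg (hκ_nonneg _ (hY.trans hYT')) (by positivity))
  have htY : 0 ≤ slice p (fun ζ ↦ ‖partialDeriv S u 1 ζ‖ ^ 2) Y :=
    slice_nonneg hp fun θ ↦ by positivity
  linarith

theorem le_slice_inner_sub (hu : IsCylinderSolution p S κ u) (hp : 0 ≤ p)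
    (hκ : ContinuousOn κ (Ici S)) (hκ_nonneg : ∀ s, S ≤ s → 0 ≤ κ s)
    (hint : IntegrableOn (fun ζ ↦ κ ζ.im * ‖u ζ‖ ^ 2) (halfCylinder p S)) {ε a b : ℝ}
    (ha : S ≤ a) (hab : a ≤ b)
    (htan : ∀ s, a ≤ s → ε ≤ slice p (fun ζ ↦ ‖partialDeriv S u 1 ζ‖ ^ 2) s) :
    2 * ε * (b - a) - 2 * ∫ ζ in halfCylinder p S, κ ζ.im * ‖u ζ‖ ^ 2 ≤
      slice p (fun ζ ↦ 2 * inner ℝ (u ζ) (partialDeriv S u Complex.I ζ)) b -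
        slice p (fun ζ ↦ 2 * inner ℝ (u ζ) (partialDeriv S u Complex.I ζ)) a := by
  have hk := hu.continuousOn_mul_norm_sq hκ
  have ht := hu.continuousOn_norm_sq_partialDeriv 1
  have htk : ContinuousOn (fun ζ ↦ 2 * (‖partialDeriv S u 1 ζ‖ ^ 2 - κ ζ.im * ‖u ζ‖ ^ 2))
      (closedHalfPlane S) := (ht.sub hk).const_mul 2
  have hdiv : ContinuousOn (fun ζ ↦ 2 * (‖partialDeriv S u 1 ζ‖ ^ 2 +
      ‖partialDeriv S u Complex.I ζ‖ ^ 2 - κ ζ.im * ‖u ζ‖ ^ 2)) (closedHalfPlane S) :=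
    ((ht.add (hu.continuousOn_norm_sq_partialDeriv _)).sub hk).const_mul 2
  have hslice := intervalIntegrable_slice_height (p := p) hk ha hab
  have hlower : ∫ s in a..b, (2 * ε - 2 * slice p (fun ζ ↦ κ ζ.im * ‖u ζ‖ ^ 2) s) ≤
      ∫ s in a..b, slice p (fun ζ ↦ 2 * (‖partialDeriv S u 1 ζ‖ ^ 2 +
        ‖partialDeriv S u Complex.I ζ‖ ^ 2 - κ ζ.im * ‖u ζ‖ ^ 2)) s := by
    refine intervalIntegral.integral_mono_on hab (intervalIntegrable_const.sub (hslice.const_mul 2))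
      (intervalIntegrable_slice_height hdiv ha hab) fun s hs ↦ ?_
    calc 2 * ε - 2 * slice p (fun ζ ↦ κ ζ.im * ‖u ζ‖ ^ 2) s
        ≤ 2 * (slice p (fun ζ ↦ ‖partialDeriv S u 1 ζ‖ ^ 2) s -
          slice p (fun ζ ↦ κ ζ.im * ‖u ζ‖ ^ 2) s) := by linarith [htan s hs.1]
      _ = slice p (fun ζ ↦ 2 * (‖partialDeriv S u 1 ζ‖ ^ 2 - κ ζ.im * ‖u ζ‖ ^ 2)) s := by
        rw [slice_const_mul, slice_sub ht hk (ha.trans hs.1)]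
      _ ≤ _ := slice_mono hp htk hdiv (ha.trans hs.1) fun θ ↦ by
        linarith [sq_nonneg ‖partialDeriv S u Complex.I ⟨θ, s⟩‖]
  rw [intervalIntegral.integral_sub (by simp) (hslice.const_mul 2), intervalIntegral.integral_const,
    intervalIntegral.integral_const_mul, smul_eq_mul] at hlower
  rw [hu.slice_inner_sub hκ ha hab]
  linarith [integral_slice_le hp hk (fun ζ hζ ↦ mul_nonneg (hκ_nonneg _ hζ) (by positivity)) hint
    ha hab]

/-- A lower bound on the tangential energy makes `∫ ‖u‖² dθ` convex, up to an integrable error. -/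
theorem exists_forall_le_slice_norm_sq (hu : IsCylinderSolution p S κ u) (hp : 0 ≤ p)
    (hκ : ContinuousOn κ (Ici S)) (hκ_nonneg : ∀ s, S ≤ s → 0 ≤ κ s)
    (hint : IntegrableOn (fun ζ ↦ κ ζ.im * ‖u ζ‖ ^ 2) (halfCylinder p S)) {ε : ℝ} (hε : 0 < ε)
    (htan : ∀ᶠ T in atTop, ε ≤ slice p (fun ζ ↦ ‖partialDeriv S u 1 ζ‖ ^ 2) T) :
    ∃ T₀, ∀ T, T₀ ≤ T → T - T₀ ≤ slice p (fun ζ ↦ ‖u ζ‖ ^ 2) T := by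
  let m := slice p fun ζ ↦ 2 * inner ℝ (u ζ) (partialDeriv S u Complex.I ζ)
  let C := ∫ ζ in halfCylinder p S, κ ζ.im * ‖u ζ‖ ^ 2
  obtain ⟨T₁, hST₁, hT₁⟩ := (htan.and (eventually_ge_atTop S)).exists_forall_of_atTop.imp
    fun T h ↦ (⟨(h T le_rfl).2, fun s hs ↦ (h s hs).1⟩ : S ≤ T ∧ ∀ s, T ≤ s → ε ≤ _)
  have hm {T : ℝ} (hT : T₁ ≤ T) : 2 * ε * (T - T₁) - 2 * C ≤ m T - m T₁ :=
    hu.le_slice_inner_sub hp hκ hκ_nonneg hint hST₁ hT hT₁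
  refine ⟨max T₁ (T₁ + (1 + 2 * C - m T₁) / (2 * ε)), fun T hT ↦ ?_⟩
  set T₀ := max T₁ (T₁ + (1 + 2 * C - m T₁) / (2 * ε))
  have hT₁₀ : T₁ ≤ T₀ := le_max_left ..
  have hT₀ : T₁ + (1 + 2 * C - m T₁) / (2 * ε) ≤ T₀ := le_max_right ..
  have hm_one : ∀ s ∈ Icc T₀ T, 1 ≤ m s := fun s hs ↦ by
    have hs' : (1 + 2 * C - m T₁) / (2 * ε) ≤ s - T₁ := by linarith [hs.1]
    rw [div_le_iff₀ (by positivity)] at hs'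
    linarith [hm (hT₁₀.trans hs.1)]
  have hgrow := intervalIntegral.integral_mono_on hT (by simp)
    (intervalIntegrable_slice_height (hu.continuousOn_inner_partialDeriv _) (hST₁.trans hT₁₀) hT)
    hm_one
  rw [intervalIntegral.integral_const, smul_eq_mul, mul_one,
    ← hu.slice_norm_sq_sub (hST₁.trans hT₁₀) hT] at hgrow
  have hnonneg : 0 ≤ slice p (fun ζ ↦ ‖u ζ‖ ^ 2) T₀ := slice_nonneg hp fun θ ↦ by positivity
  linarith

/-- Otherwise `∫ ‖u‖² dθ` would grow linearly, and `∬ κ ‖u‖²` would diverge logarithmically. -/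
theorem frequently_slice_partialDeriv_one_lt (hu : IsCylinderSolution p S κ u) (hp : 0 ≤ p)
    (hκ : ContinuousOn κ (Ici S)) {c : ℝ} (hc : 0 < c) (hS : 0 < S)
    (hκc : ∀ s, S ≤ s → c / s ^ 2 ≤ κ s)
    (hint : IntegrableOn (fun ζ ↦ κ ζ.im * ‖u ζ‖ ^ 2) (halfCylinder p S)) {ε : ℝ} (hε : 0 < ε) :
    ∃ᶠ T in atTop, slice p (fun ζ ↦ ‖partialDeriv S u 1 ζ‖ ^ 2) T < ε := by
  by_contra htan
  have htan' : ∀ᶠ T in atTop, ε ≤ slice p (fun ζ ↦ ‖partialDeriv S u 1 ζ‖ ^ 2) T := by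
    simpa only [not_frequently, not_lt] using htan
  have hκ_nonneg : ∀ s, S ≤ s → 0 ≤ κ s := fun s hs ↦ le_trans (by positivity) (hκc s hs)
  obtain ⟨T₀, hT₀⟩ := hu.exists_forall_le_slice_norm_sq hp hκ hκ_nonneg hint hε htan'
  let T₁ := max S (2 * |T₀|)
  have hT₁ : 0 < T₁ := hS.trans_le (le_max_left ..)
  have hk := hu.continuousOn_mul_norm_sq hκ
  have hlower {s : ℝ} (hs : T₁ ≤ s) :
      c / 2 * s⁻¹ ≤ slice p (fun ζ ↦ κ ζ.im * ‖u ζ‖ ^ 2) s := by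
    have hs_pos := hT₁.trans_le hs
    have hSs := (le_max_left ..).trans hs
    have hs₀ : 2 * |T₀| ≤ s := (le_max_right ..).trans hs
    have hT₀s : T₀ ≤ s / 2 := by linarith [le_abs_self T₀]
    calc c / 2 * s⁻¹ = c / s ^ 2 * (s / 2) := by field_simp
      _ ≤ κ s * slice p (fun ζ ↦ ‖u ζ‖ ^ 2) s :=
        mul_le_mul (hκc s hSs) (by linarith [hT₀ s (by linarith)]) (by positivity) (hκ_nonneg s hSs)
      _ = _ := (slice_const_mul (κ s) _ s).symm
  have hlog {T : ℝ} (hT : T₁ ≤ T) : c / 2 * Real.log (T / T₁) ≤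
      ∫ ζ in halfCylinder p S, κ ζ.im * ‖u ζ‖ ^ 2 := by
    rw [← integral_inv_of_pos hT₁ (hT₁.trans_le hT), ← intervalIntegral.integral_const_mul]
    have hinv : IntervalIntegrable (fun s : ℝ ↦ c / 2 * s⁻¹) volume T₁ T :=
      (intervalIntegral.intervalIntegrable_inv (fun s hs ↦
        (hT₁.trans_le (by rw [uIcc_of_le hT] at hs; exact hs.1)).ne') continuousOn_id).const_mul _
    exact (intervalIntegral.integral_mono_on hT hinv
      (intervalIntegrable_slice_height hk (le_max_left ..) hT) fun s hs ↦ hlower hs.1).trans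
      (integral_slice_le hp hk (fun ζ hζ ↦ mul_nonneg (hκ_nonneg _ hζ) (by positivity)) hint
        (le_max_left ..) hT)
  have hdiv : Tendsto (fun T ↦ c / 2 * Real.log (T / T₁)) atTop atTop :=
    (Real.tendsto_log_atTop.comp (tendsto_id.atTop_div_const hT₁)).const_mul_atTop (half_pos hc)
  obtain ⟨T, hT, hT'⟩ := ((eventually_ge_atTop T₁).and (hdiv.eventually_gt_atTop _)).exists
  exact (hlog hT).not_gt hT'

end IsCylinderSolution

section Area

theorem measurable_density :
    Measurable fun z : ℍ ↦ (1 / NNReal.mk z.im z.im_pos.le : NNReal) ^ 2 := by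
  have him : Measurable fun z : ℍ ↦ NNReal.mk z.im z.im_pos.le :=
    continuous_im.measurable.subtype_mk
  exact (measurable_const.div him).pow_const 2

theorem setIntegral_eq_setIntegral_coe_image {Q : Set ℍ} (hQ : MeasurableSet Q) (f : ℍ → ℝ) :
    (IntegrableOn f Q ↔
      IntegrableOn (fun z ↦ (z.im ^ 2)⁻¹ * inCoord f z) (UpperHalfPlane.coe '' Q)) ∧
      ∫ z in Q, f z = ∫ z in UpperHalfPlane.coe '' Q, (z.im ^ 2)⁻¹ * inCoord f z := by
  have hcoe : MeasurePreserving UpperHalfPlane.coe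
      ((volume : Measure ℂ).comap UpperHalfPlane.coe)
      (volume.restrict (range UpperHalfPlane.coe)) :=
    ⟨measurable_coe, by rw [measurableEmbedding_coe.map_comap]⟩
  have hrestrict : (volume.restrict (range UpperHalfPlane.coe)).restrict (UpperHalfPlane.coe '' Q) =
      (volume : Measure ℂ).restrict (UpperHalfPlane.coe '' Q) :=
    Measure.restrict_restrict_of_subset (image_subset_range _ _)
  have hdensity : (fun z : ℍ ↦ ((1 / NNReal.mk z.im z.im_pos.le : NNReal) ^ 2) • f z) =
      (fun z ↦ (z.im ^ 2)⁻¹ * inCoord f z) ∘ UpperHalfPlane.coe := by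
    funext z
    simp [NNReal.smul_def, inCoord, ofComplex_apply]
  rw [IntegrableOn, IntegrableOn, ← hrestrict, volume_def]
  constructor
  · rw [restrict_withDensity hQ, integrable_withDensity_iff_integrable_smul measurable_density,
      hdensity]
    exact (hcoe.integrableOn_image measurableEmbedding_coe).symm
  · rw [setIntegral_withDensity_eq_setIntegral_smul measurable_density _ hQ, hdensity,
      hcoe.setIntegral_image_emb measurableEmbedding_coe]
    rfl

theorem det_smul_one (c : ℂ) : (c • (1 : ℂ →L[ℝ] ℂ)).det = ‖c‖ ^ 2 := by
  rw [Complex.sq_norm, ← Algebra.norm_complex_apply, Algebra.norm_apply]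
  rfl

theorem setIntegral_eq_setIntegral_holomorphic {P : ℂ → ℂ} {T : Set ℂ} {Q : Set ℍ}
    (hT : MeasurableSet T) (hP : ∀ ζ ∈ T, DifferentiableAt ℂ P ζ) (hinj : InjOn P T)
    (hQ : UpperHalfPlane.coe '' Q = P '' T) (f : ℍ → ℝ) :
    (IntegrableOn f Q ↔
      IntegrableOn (fun ζ ↦ (‖deriv P ζ‖ / (P ζ).im) ^ 2 * inCoord f (P ζ)) T) ∧
      ∫ z in Q, f z = ∫ ζ in T, (‖deriv P ζ‖ / (P ζ).im) ^ 2 * inCoord f (P ζ) := by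
  have hP' : ∀ ζ ∈ T, HasFDerivWithinAt P (deriv P ζ • (1 : ℂ →L[ℝ] ℂ)) T ζ := fun ζ hζ ↦
    (hP ζ hζ).hasDerivAt.complexToReal_fderiv.hasFDerivWithinAt
  have hmeas : MeasurableSet Q := measurableEmbedding_coe.measurableSet_image.mp
    (hQ ▸ measurable_image_of_fderivWithin hT hP' hinj)
  have hjac : ∀ ζ, |(deriv P ζ • (1 : ℂ →L[ℝ] ℂ)).det| • (((P ζ).im ^ 2)⁻¹ * inCoord f (P ζ)) =
      (‖deriv P ζ‖ / (P ζ).im) ^ 2 * inCoord f (P ζ) := fun ζ ↦ by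
    rw [det_smul_one, abs_of_nonneg (by positivity), smul_eq_mul, div_pow, div_eq_mul_inv,
      mul_assoc]
  obtain ⟨hint, heq⟩ := setIntegral_eq_setIntegral_coe_image hmeas f
  constructor
  · rw [hint, hQ, integrableOn_image_iff_integrableOn_abs_det_fderiv_smul volume hT hP' hinj]
    simp only [hjac]
  · rw [heq, hQ, integral_image_eq_integral_abs_det_fderiv_smul volume hT hP' hinj]
    simp only [hjac]

end Area

section Conformal

variable {F : Type*} [NormedAddCommGroup F] [NormedSpace ℝ F]

theorem fderiv_fderiv_add_rotate {φ : ℂ → F} {z : ℂ} (h : ContDiffAt ℝ 2 φ z) (v : ℂ) :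
    fderiv ℝ (fderiv ℝ φ) z v v + fderiv ℝ (fderiv ℝ φ) z (v * Complex.I) (v * Complex.I) =
      ‖v‖ ^ 2 • Laplacian.laplacian φ z := by
  have hsymm := (h.isSymmSndFDerivAt (by simp)).eq 1 Complex.I
  have hv : v = v.re • (1 : ℂ) + v.im • Complex.I := by simp [Complex.re_add_im]
  have hIv : v * Complex.I = (-v.im) • (1 : ℂ) + v.re • Complex.I := by
    apply Complex.ext <;> simp
  rw [laplacian_eq_fderiv_fderiv, Complex.sq_norm, Complex.normSq_apply, hIv]
  generalize v.re = a at *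
  generalize v.im = b at *
  subst hv
  simp only [map_add, map_smul, add_apply, smul_apply, hsymm]
  module

theorem laplacian_comp_holomorphic {φ : ℂ → F} {P : ℂ → ℂ} {ζ : ℂ} (hP : AnalyticAt ℂ P ζ)
    (hφ : ContDiffAt ℝ 2 φ (P ζ)) :
    Laplacian.laplacian (φ ∘ P) ζ = ‖deriv P ζ‖ ^ 2 • Laplacian.laplacian φ (P ζ) := by
  have hfderiv : ∀ᶠ ξ in 𝓝 ζ, fderiv ℝ (φ ∘ P) ξ =
      fderiv ℝ φ (P ξ) ∘L (deriv P ξ • (1 : ℂ →L[ℝ] ℂ)) := by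
    filter_upwards [hP.eventually_analyticAt,
      hP.continuousAt.eventually (hφ.eventually (by simp))] with ξ hPξ hφξ
    exact ((hφξ.differentiableAt two_ne_zero).hasFDerivAt.comp ξ
      hPξ.differentiableAt.hasDerivAt.complexToReal_fderiv).fderiv
  have hD : HasFDerivAt (fun ξ ↦ fderiv ℝ φ (P ξ))
      (fderiv ℝ (fderiv ℝ φ) (P ζ) ∘L (deriv P ζ • (1 : ℂ →L[ℝ] ℂ))) ζ :=
    ((hφ.fderiv_right one_add_one_eq_two.le).differentiableAt one_ne_zero).hasFDerivAt.comp ζ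
      hP.differentiableAt.hasDerivAt.complexToReal_fderiv
  have hP' := hP.deriv.differentiableAt.hasDerivAt.complexToReal_fderiv
  have hsecond (v : ℂ) : fderiv ℝ (fderiv ℝ (φ ∘ P)) ζ v v =
      fderiv ℝ (fderiv ℝ φ) (P ζ) (deriv P ζ * v) (deriv P ζ * v) +
        fderiv ℝ φ (P ζ) (deriv (deriv P) ζ * v * v) := by
    have hlin : HasFDerivAt (fun ξ ↦ deriv P ξ • (1 : ℂ →L[ℝ] ℂ)) _ ζ := hP'.smul_const _
    rw [((hD.clm_comp hlin).congr_of_eventuallyEq hfderiv).fderiv]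
    simp [add_comm, mul_comm v, mul_assoc]
  rw [laplacian_eq_fderiv_fderiv, hsecond, hsecond, ← fderiv_fderiv_add_rotate hφ]
  have hcancel : deriv (deriv P) ζ * Complex.I * Complex.I = -(deriv (deriv P) ζ * 1 * 1) := by
    rw [mul_assoc, Complex.I_mul_I]
    ring
  rw [hcancel, map_neg, mul_one]
  abel

end Conformal

/-- A conformal parametrization `P` of (part of) `K ⊆ ℍ` by the half-plane `im ζ ≥ S`, in which the
hyperbolic metric is `ρ(im ζ) |dζ|`. -/
structure IsConformalChart (P : ℂ → ℂ) (ρ : ℝ → ℝ) (S : ℝ) (K : Set ℍ) : Prop where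
  analyticAt : ∀ ζ ∈ closedHalfPlane S, AnalyticAt ℂ P ζ
  mapsTo : MapsTo P (closedHalfPlane S) (UpperHalfPlane.coe '' K)
  norm_deriv : ∀ ζ ∈ closedHalfPlane S, ‖deriv P ζ‖ = ρ ζ.im * (P ζ).im
  pos : ∀ s, S ≤ s → 0 < ρ s

namespace IsConformalChart

variable {𝕜 : Type*} [RCLike 𝕜] {P : ℂ → ℂ} {ρ : ℝ → ℝ} {p S lam : ℝ} {K : Set ℍ} {ψ : ℍ → 𝕜}

theorem im_pos (hP : IsConformalChart P ρ S K) {ζ : ℂ} (hζ : S ≤ ζ.im) : 0 < (P ζ).im := by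
  obtain ⟨z, -, hz⟩ := hP.mapsTo hζ
  exact hz ▸ z.im_pos

theorem deriv_ne_zero (hP : IsConformalChart P ρ S K) {ζ : ℂ} (hζ : S ≤ ζ.im) :
    deriv P ζ ≠ 0 := by
  rw [← norm_pos_iff, hP.norm_deriv ζ hζ]
  exact mul_pos (hP.pos _ hζ) (hP.im_pos hζ)

theorem mem_interior (hP : IsConformalChart P ρ S K) {ζ : ℂ} (hζ : S < ζ.im) :
    P ζ ∈ interior (UpperHalfPlane.coe '' K) := by
  rw [mem_interior_iff_mem_nhds, ← (hP.analyticAt ζ hζ.le).hasStrictDerivAt.map_nhds_eq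
    (hP.deriv_ne_zero hζ.le)]
  exact mem_map.mpr (mem_of_superset (mem_nhds_closedHalfPlane hζ) hP.mapsTo)

theorem isCylinderSolution (hP : IsConformalChart P ρ S K) (hψ : IsEigenfunctionOn K lam ψ)
    (hper : ∀ ζ ∈ closedHalfPlane S, inCoord ψ (P (ζ + (2 * p : ℝ))) = inCoord ψ (P ζ)) :
    IsCylinderSolution p S (fun s ↦ lam * ρ s ^ 2) (inCoord ψ ∘ P) where
  contDiffOn := hψ.contDiffOn.comp (fun ζ hζ ↦
    ((hP.analyticAt ζ hζ).restrictScalars (𝕜 := ℝ)).contDiffAt.contDiffWithinAt) hP.mapsTo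
  laplacian_eq ζ hζ := by
    have hK := hP.mem_interior hζ
    obtain ⟨z, -, hz⟩ := hP.mapsTo hζ.le
    have hzK : z ∈ interior K := by
      rw [← hz] at hK
      have := preimage_interior_subset_interior_preimage continuous_coe hK
      rwa [preimage_image_eq K coe_injective] at this
    have heigen : z.im ^ 2 • Laplacian.laplacian (inCoord ψ) (z : ℂ) = -(lam • ψ z) :=
      neg_eq_iff_eq_neg.mp (hψ.eigen z hzK)
    have hψz : inCoord ψ (P ζ) = ψ z := by rw [← hz, inCoord, ofComplex_apply]
    rw [laplacian_comp_holomorphic (hP.analyticAt ζ hζ.le)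
      (hψ.contDiffOn.contDiffAt (mem_interior_iff_mem_nhds.mp hK)), hP.norm_deriv ζ hζ.le,
      Function.comp_apply, hψz, ← hz, mul_pow, mul_smul, coe_im, heigen, smul_neg, smul_smul,
      mul_comm]
  periodic := hper

theorem partialDeriv_comp (hP : IsConformalChart P ρ S K) (hψ : IsEigenfunctionOn K lam ψ)
    {ζ : ℂ} (hζ : S ≤ ζ.im) (v : ℂ) : partialDeriv S (inCoord ψ ∘ P) v ζ =
      fderivWithin ℝ (inCoord ψ) (UpperHalfPlane.coe '' K) (P ζ) (deriv P ζ * v) := by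
  have hψ' := ((hψ.contDiffOn _ (hP.mapsTo hζ)).differentiableWithinAt
    two_ne_zero).hasFDerivWithinAt
  have hP' := (hP.analyticAt ζ hζ).differentiableAt.hasDerivAt.complexToReal_fderiv
    |>.hasFDerivWithinAt (s := closedHalfPlane S)
  rw [partialDeriv, (hψ'.comp ζ hP' hP.mapsTo).fderivWithin (uniqueDiffOn_closedHalfPlane S ζ hζ)]
  rfl

variable {γ : ℝ → ℍ} {Y : ℝ}

theorem velocity_eq (hP : IsConformalChart P ρ S K) (hY : S ≤ Y)
    (hγ : ∀ θ : ℝ, (γ θ : ℂ) = P ⟨θ, Y⟩) (θ : ℝ) : velocity γ θ = deriv P ⟨θ, Y⟩ := by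
  have hline : HasDerivAt (fun θ : ℝ ↦ (⟨θ, Y⟩ : ℂ)) 1 θ := by
    simpa [← Complex.mk_eq_add_mul_I] using
      (Complex.ofRealCLM.hasDerivAt (x := θ)).add_const (Y * Complex.I)
  have hcomp := ((hP.analyticAt ⟨θ, Y⟩ hY).differentiableAt.hasDerivAt).scomp θ hline
  simpa [velocity, hγ, Function.comp_def] using hcomp.deriv

theorem normalDeriv_eq (hP : IsConformalChart P ρ S K) (hψ : IsEigenfunctionOn K lam ψ)
    (hY : S ≤ Y) (hγ : ∀ θ : ℝ, (γ θ : ℂ) = P ⟨θ, Y⟩) (θ : ℝ) :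
    normalDeriv K ψ γ θ = (ρ Y)⁻¹ • partialDeriv S (inCoord ψ ∘ P) Complex.I ⟨θ, Y⟩ := by
  have him : (γ θ).im = (P ⟨θ, Y⟩).im := by rw [← hγ, coe_im]
  have hnormal : unitNormal γ θ = (ρ Y)⁻¹ • (deriv P ⟨θ, Y⟩ * Complex.I) := by
    have hρ : (ρ Y : ℂ) ≠ 0 := mod_cast (hP.pos Y hY).ne'
    have hne : ((P ⟨θ, Y⟩).im : ℂ) ≠ 0 := mod_cast (hP.im_pos hY).ne'
    rw [unitNormal, hP.velocity_eq hY hγ, hP.norm_deriv _ hY, him, Complex.real_smul]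
    push_cast
    field_simp
  rw [normalDeriv, hnormal, hγ, map_smul, hP.partialDeriv_comp hψ hY]

theorem restrictedNorm_eq (hP : IsConformalChart P ρ S K) (hψ : IsEigenfunctionOn K lam ψ)
    (hu : IsCylinderSolution p S (fun s ↦ lam * ρ s ^ 2) (inCoord ψ ∘ P)) (hlam : lam ≠ 0)
    (hY : S ≤ Y) (hγ : ∀ θ : ℝ, (γ θ : ℂ) = P ⟨θ, Y⟩) :
    lam * (ρ Y * restrictedNorm K lam ψ γ (-p) p) =
      slice p (fun ζ ↦ ‖partialDeriv S (inCoord ψ ∘ P) Complex.I ζ‖ ^ 2 +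
        lam * ρ ζ.im ^ 2 * ‖(inCoord ψ ∘ P) ζ‖ ^ 2) Y := by
  have hρ := hP.pos Y hY
  have hspeed (θ : ℝ) : ‖velocity γ θ‖ / (γ θ).im = ρ Y := by
    have him : (γ θ).im = (P ⟨θ, Y⟩).im := by rw [← hγ, coe_im]
    rw [hP.velocity_eq hY hγ, hP.norm_deriv _ hY, him, mul_div_cancel_right₀ _ (hP.im_pos hY).ne']
  have hvalue (θ : ℝ) : ψ (γ θ) = (inCoord ψ ∘ P) ⟨θ, Y⟩ := by
    rw [Function.comp_apply, ← hγ, inCoord, ofComplex_apply]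
  have hsq : ContinuousOn (fun ζ ↦ ‖(inCoord ψ ∘ P) ζ‖ ^ 2) (closedHalfPlane S) :=
    hu.contDiffOn.continuousOn.norm.pow 2
  simp only [restrictedNorm, arclengthIntegral, hspeed, hvalue, hP.normalDeriv_eq hψ hY hγ,
    norm_smul, norm_inv, Real.norm_of_nonneg hρ.le, mul_pow, slice]
  rw [intervalIntegral.integral_mul_const, intervalIntegral.integral_mul_const,
    intervalIntegral.integral_const_mul, intervalIntegral.integral_add
      (intervalIntegrable_slice (hu.continuousOn_norm_sq_partialDeriv _) hY _ _)
      ((intervalIntegrable_slice hsq hY _ _).const_mul _),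
    intervalIntegral.integral_const_mul]
  field_simp
  ring

theorem setIntegral_mul_norm_sq_le (hP : IsConformalChart P ρ S K) (hψ : IsEigenfunctionOn K lam ψ)
    (hu : IsCylinderSolution p S (fun s ↦ lam * ρ s ^ 2) (inCoord ψ ∘ P)) (hlam : 0 < lam)
    (hp : 0 ≤ p) {ρ' : ℝ → ℝ} (hρ : ∀ s, S ≤ s → HasDerivAt ρ (ρ' s) s)
    (hρ' : ContinuousOn ρ' (Ici S)) (hρ'_nonpos : ∀ s, S ≤ s → ρ' s ≤ 0)
    (htan : ∀ ε > 0, ∃ᶠ T in atTop,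
      slice p (fun ζ ↦ ‖partialDeriv S (inCoord ψ ∘ P) 1 ζ‖ ^ 2) T < ε)
    (hY : S ≤ Y) (hγ : ∀ θ : ℝ, (γ θ : ℂ) = P ⟨θ, Y⟩) (hinj : InjOn P (halfCylinder p Y))
    {Q : Set ℍ} (hQ : UpperHalfPlane.coe '' Q = P '' halfCylinder p Y) {g : ℍ → ℝ}
    (hg : ∀ ζ ∈ halfCylinder p Y, inCoord g (P ζ) = -ρ' ζ.im / ρ ζ.im) :
    IntegrableOn (fun z ↦ g z * ‖ψ z‖ ^ 2) Q ∧
      2 * ∫ z in Q, g z * ‖ψ z‖ ^ 2 ≤ ρ Y * restrictedNorm K lam ψ γ (-p) p := by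
  have hρ_cont : ContinuousOn ρ (Ici S) := fun s hs ↦ (hρ s hs).continuousAt.continuousWithinAt
  obtain ⟨hint, hle⟩ := hu.setIntegral_neg_deriv_mul_norm_sq_le hp
    (κ' := fun s ↦ 2 * lam * (ρ s * ρ' s))
    (fun s hs ↦ (((hρ s hs).pow 2).const_mul lam).congr_deriv (by simp; ring))
    (continuousOn_const.mul (hρ_cont.mul hρ')) (fun s _ ↦ by positivity)
    (fun s hs ↦ mul_nonpos_of_nonneg_of_nonpos (by positivity)
      (mul_nonpos_of_nonneg_of_nonpos (hP.pos s hs).le (hρ'_nonpos s hs))) htan hY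
  have hsubset : halfCylinder p Y ⊆ closedHalfPlane S :=
    (halfCylinder_subset p Y).trans (closedHalfPlane_anti hY)
  obtain ⟨hint_iff, hint_eq⟩ := setIntegral_eq_setIntegral_holomorphic
    (measurableSet_halfCylinder p Y)
    (fun ζ hζ ↦ (hP.analyticAt ζ (hsubset hζ)).differentiableAt) hinj hQ
    (fun z ↦ g z * ‖ψ z‖ ^ 2)
  have hintegrand : EqOn (fun ζ ↦ (‖deriv P ζ‖ / (P ζ).im) ^ 2 *
        inCoord (fun z ↦ g z * ‖ψ z‖ ^ 2) (P ζ))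
      (fun ζ ↦ (2 * lam)⁻¹ * (-(2 * lam * (ρ ζ.im * ρ' ζ.im)) * ‖(inCoord ψ ∘ P) ζ‖ ^ 2))
      (halfCylinder p Y) := fun ζ hζ ↦ by
    have hgζ : g (ofComplex (P ζ)) = -ρ' ζ.im / ρ ζ.im := hg ζ hζ
    have hρζ := (hP.pos _ (hsubset hζ)).ne'
    simp only [inCoord, Function.comp_apply, hgζ]
    rw [hP.norm_deriv ζ (hsubset hζ), mul_div_cancel_right₀ _ (hP.im_pos (hsubset hζ)).ne']
    field_simp
  refine ⟨hint_iff.mpr ((integrableOn_congr_fun hintegrand (measurableSet_halfCylinder p Y)).mpr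
    (hint.const_mul _)), le_of_mul_le_mul_left ?_ hlam⟩
  rw [hint_eq, setIntegral_congr_fun (measurableSet_halfCylinder p Y) hintegrand,
    integral_const_mul, hP.restrictedNorm_eq hψ hu hlam.ne' hY hγ, ← mul_assoc, ← mul_assoc,
    mul_comm lam, mul_inv_cancel₀ (by positivity), one_mul]
  exact hle

end IsConformalChart

section Horocycle

variable {𝕜 : Type*} [RCLike 𝕜] {A Y lam : ℝ} {ψ : ℍ → 𝕜}

theorem coe_image_setOf {q : ℂ → Prop} (hq : ∀ z, q z → 0 < z.im) :
    UpperHalfPlane.coe '' {z : ℍ | q z} = {z | q z} :=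
  Subset.antisymm (image_subset_iff.mpr fun _ hz ↦ hz) fun z hz ↦ ⟨⟨z, hq z hz⟩, hz, rfl⟩

theorem coe_image_cuspRegion (hA : 0 < A) :
    UpperHalfPlane.coe '' cuspRegion A = closedHalfPlane A :=
  coe_image_setOf fun _ hz ↦ hA.trans_le hz

theorem coe_image_cuspStrip (hY : 0 < Y) :
    UpperHalfPlane.coe '' cuspStrip Y = halfCylinder (1 / 2) Y := by
  have h := coe_image_setOf (q := fun z ↦ -(1 / 2) < z.re ∧ z.re ≤ 1 / 2 ∧ Y ≤ z.im)
    fun _ hz ↦ hY.trans_le hz.2.2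
  refine h.trans (ext fun z ↦ ?_)
  simp [halfCylinder, Complex.mem_reProdIm, and_assoc]

theorem measurableSet_cuspStrip (hY : 0 < Y) : MeasurableSet (cuspStrip Y) :=
  measurableEmbedding_coe.measurableSet_image.mp
    (coe_image_cuspStrip hY ▸ measurableSet_halfCylinder _ _)

theorem setIntegral_cuspStrip (hY : 0 < Y) (f : ℍ → ℝ) :
    (IntegrableOn f (cuspStrip Y) ↔
      IntegrableOn (fun z ↦ (z.im ^ 2)⁻¹ * inCoord f z) (halfCylinder (1 / 2) Y)) ∧
      ∫ z in cuspStrip Y, f z = ∫ z in halfCylinder (1 / 2) Y, (z.im ^ 2)⁻¹ * inCoord f z :=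
  coe_image_cuspStrip hY ▸ setIntegral_eq_setIntegral_coe_image (measurableSet_cuspStrip hY) f

theorem isConformalChart_id (hA : 0 < A) : IsConformalChart id (·⁻¹) A (cuspRegion A) where
  analyticAt _ _ := analyticAt_id
  mapsTo := coe_image_cuspRegion hA ▸ mapsTo_id _
  norm_deriv ζ hζ := by simp [(hA.trans_le hζ).ne']
  pos _ hs := inv_pos.mpr (hA.trans_le hs)

theorem IsCuspEigenfunction.isCylinderSolution (hA : 0 < A) (hψ : IsCuspEigenfunction A lam ψ) :
    IsCylinderSolution (1 / 2) A (fun s ↦ lam * s⁻¹ ^ 2) (inCoord ψ ∘ id) :=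
  (isConformalChart_id hA).isCylinderSolution hψ.eigenfunction fun ζ hζ ↦ by
    lift ζ to ℍ using hA.trans_le hζ
    have hadd : (ζ : ℂ) + (2 * (1 / 2) : ℝ) = ((1 : ℝ) +ᵥ ζ : ℍ) := by
      simp [add_comm]
    simp only [id, hadd, inCoord, ofComplex_apply]
    exact hψ.periodic ζ hζ

theorem IsCuspEigenfunction.integrableOn_norm_sq (hA : 0 < A) (hψ : IsCuspEigenfunction A lam ψ) :
    IntegrableOn (fun ζ ↦ lam * ζ.im⁻¹ ^ 2 * ‖inCoord ψ ζ‖ ^ 2) (halfCylinder (1 / 2) A) := by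
  have hint : IntegrableOn (fun z ↦ ‖ψ z‖ ^ 2) (cuspStrip A) :=
    (memLp_two_iff_integrable_sq_norm hψ.memLp.aestronglyMeasurable).mp hψ.memLp
  refine (((setIntegral_cuspStrip hA _).1.mp hint).const_mul lam).congr (ae_of_all _ fun ζ ↦ ?_)
  simp only [inCoord, inv_pow, mul_assoc]

theorem restriction_horocycle (hA : 0 < A) (hY : A ≤ Y) (hlam : 0 < lam)
    (hψ : IsCuspEigenfunction A lam ψ) :
    IntegrableOn (fun z ↦ ‖ψ z‖ ^ 2 * z.im⁻¹) (cuspStrip Y) ∧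
      2 * Y * ∫ z in cuspStrip Y, ‖ψ z‖ ^ 2 * z.im⁻¹ ≤
        restrictedNorm (cuspRegion A) lam ψ (horocycle Y (hA.trans_le hY)) (-(1 / 2)) (1 / 2) := by
  have hY0 := hA.trans_le hY
  have hne : ∀ s, A ≤ s → s ≠ 0 := fun s hs ↦ (hA.trans_le hs).ne'
  have hu := hψ.isCylinderSolution hA
  have hinv : ContinuousOn (fun s : ℝ ↦ lam * s⁻¹ ^ 2) (Ici A) :=
    continuousOn_const.mul ((continuousOn_id.inv₀ hne).pow 2)
  have htan : ∀ ε > 0, ∃ᶠ T in atTop, slice (1 / 2) (fun ζ ↦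
      ‖partialDeriv A (inCoord ψ ∘ id) 1 ζ‖ ^ 2) T < ε := fun ε hε ↦
    hu.frequently_slice_partialDeriv_one_lt (by norm_num) hinv hlam hA
      (fun s _ ↦ by simp [div_eq_mul_inv]) (hψ.integrableOn_norm_sq hA) hε
  obtain ⟨hint, hle⟩ := (isConformalChart_id hA).setIntegral_mul_norm_sq_le hψ.eigenfunction hu
    hlam (by norm_num) (fun s hs ↦ hasDerivAt_inv (hne s hs))
    ((continuousOn_id.pow 2).inv₀ fun s hs ↦ pow_ne_zero 2 (hne s hs)).neg
    (fun s _ ↦ neg_nonpos.mpr (by positivity)) htan hY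
    (γ := horocycle Y hY0) (fun _ ↦ rfl) (injOn_id _)
    (Q := cuspStrip Y) (by rw [image_id, coe_image_cuspStrip hY0])
    (g := fun z ↦ z.im⁻¹) fun ζ hζ ↦ by
      have hζ0 : 0 < ζ.im := hY0.trans_le hζ.2
      rw [id, inCoord, ofComplex_apply_of_im_pos hζ0]
      field_simp
      rfl
  simp only [mul_comm _ (‖ψ _‖ ^ 2)] at hint hle
  refine ⟨hint, ?_⟩
  rwa [inv_mul_eq_div, le_div_iff₀ hY0, mul_right_comm] at hle

end Horocycle

section ConjugateRadius

/-- The height at which the circle of radius `r` appears in the cylinder model of the punctured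
disc, determined by `sinh r * sinh (conjRadius r) = 1`. It is an involution of `(0, ∞)`. -/
def conjRadius (r : ℝ) : ℝ := Real.arsinh (Real.sinh r)⁻¹

variable {r s : ℝ}

theorem sinh_conjRadius (r : ℝ) : Real.sinh (conjRadius r) = (Real.sinh r)⁻¹ :=
  Real.sinh_arsinh _

theorem conjRadius_conjRadius (r : ℝ) : conjRadius (conjRadius r) = r := by
  rw [conjRadius, sinh_conjRadius, inv_inv, Real.arsinh_sinh]

theorem conjRadius_pos (hr : 0 < r) : 0 < conjRadius r :=
  Real.arsinh_pos_iff.mpr (inv_pos.mpr (Real.sinh_pos_iff.mpr hr))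

theorem conjRadius_le_conjRadius (hr : 0 < r) (hrs : r ≤ s) : conjRadius s ≤ conjRadius r :=
  Real.arsinh_le_arsinh.mpr
    (inv_anti₀ (Real.sinh_pos_iff.mpr hr) (Real.sinh_le_sinh.mpr hrs))

theorem cosh_conjRadius (hr : 0 < r) : Real.cosh (conjRadius r) = Real.cosh r / Real.sinh r := by
  have hsinh := Real.sinh_pos_iff.mpr hr
  refine (sq_eq_sq₀ (Real.cosh_pos _).le (div_pos (Real.cosh_pos r) hsinh).le).mp ?_
  rw [Real.cosh_sq, sinh_conjRadius, div_pow, Real.cosh_sq r]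
  field_simp
  ring

end ConjugateRadius

section DiscChart

/-- The punctured disc about `w` as a half-infinite cylinder: `θ + i s ↦ polar w r θ`, where
`r = conjRadius s`. -/
def discChart (w : ℍ) (ζ : ℂ) : ℂ := w.re + w.im * Complex.tan (ζ / 2)

variable {w : ℍ} {ζ : ℂ}

theorem add_conj_div_two (ζ : ℂ) : ζ / 2 + (starRingEnd ℂ) (ζ / 2) = ζ.re := by
  rw [Complex.add_conj, Complex.div_ofNat_re]
  push_cast
  ring

theorem sub_conj_div_two (ζ : ℂ) : ζ / 2 - (starRingEnd ℂ) (ζ / 2) = ζ.im * Complex.I := by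
  rw [Complex.sub_conj, Complex.div_ofNat_im]
  push_cast
  ring

theorem cos_add_cosh_eq (ζ : ℂ) :
    Real.cos ζ.re + Real.cosh ζ.im = 2 * ‖Complex.cos (ζ / 2)‖ ^ 2 := by
  have h : Complex.cos ζ.re + Complex.cosh ζ.im =
      2 * (Complex.cos (ζ / 2) * (starRingEnd ℂ) (Complex.cos (ζ / 2))) := by
    rw [← Complex.cos_conj, ← Complex.cos_mul_I, ← add_conj_div_two, ← sub_conj_div_two,
      Complex.cos_add, Complex.cos_sub]
    ring
  rw [Complex.mul_conj, Complex.normSq_eq_norm_sq] at h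
  exact_mod_cast h

theorem tan_half_eq (ζ : ℂ) : Complex.tan (ζ / 2) =
    ⟨Real.sin ζ.re / (Real.cos ζ.re + Real.cosh ζ.im),
      Real.sinh ζ.im / (Real.cos ζ.re + Real.cosh ζ.im)⟩ := by
  have h : Complex.sin ζ.re + Complex.sinh ζ.im * Complex.I =
      2 * (Complex.sin (ζ / 2) * (starRingEnd ℂ) (Complex.cos (ζ / 2))) := by
    rw [← Complex.cos_conj, ← Complex.sin_mul_I, ← add_conj_div_two, ← sub_conj_div_two,
      Complex.sin_add, Complex.sin_sub]
    ring
  rw [cos_add_cosh_eq, Complex.tan_eq_sin_div_cos, Complex.mk_eq_add_mul_I]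
  rcases eq_or_ne (Complex.cos (ζ / 2)) 0 with hcos | hcos
  · simp [hcos]
  have hconj : (starRingEnd ℂ) (Complex.cos (ζ / 2)) ≠ 0 :=
    (map_ne_zero_iff _ (starRingEnd ℂ).injective).mpr hcos
  push_cast
  rw [← Complex.mul_conj', div_mul_eq_mul_div, ← add_div, h]
  field_simp

theorem discChart_re (w : ℍ) (ζ : ℂ) : (discChart w ζ).re =
    w.re + w.im * (Real.sin ζ.re / (Real.cos ζ.re + Real.cosh ζ.im)) := by
  rw [discChart, tan_half_eq]
  simp only [Complex.add_re, Complex.ofReal_re, Complex.re_ofReal_mul]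

theorem discChart_im (w : ℍ) (ζ : ℂ) : (discChart w ζ).im =
    w.im * (Real.sinh ζ.im / (Real.cos ζ.re + Real.cosh ζ.im)) := by
  rw [discChart, tan_half_eq]
  simp only [Complex.add_im, Complex.ofReal_im, Complex.im_ofReal_mul, zero_add]

theorem cos_add_cosh_pos (hζ : 0 < ζ.im) : 0 < Real.cos ζ.re + Real.cosh ζ.im := by
  linarith [Real.neg_one_le_cos ζ.re, Real.one_lt_cosh.mpr hζ.ne']

theorem cos_half_ne_zero (hζ : 0 < ζ.im) : Complex.cos (ζ / 2) ≠ 0 := fun h ↦ by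
  have hpos := cos_add_cosh_pos hζ
  simp [cos_add_cosh_eq, h] at hpos

theorem discChart_eq_polar (w : ℍ) (hζ : 0 < ζ.im) :
    discChart w ζ = polar w (conjRadius ζ.im) ζ.re := by
  have hsinh := (Real.sinh_pos_iff.mpr hζ).ne'
  have hpos := (cos_add_cosh_pos hζ).ne'
  have hsum : Real.cosh (conjRadius ζ.im) + Real.sinh (conjRadius ζ.im) * Real.cos ζ.re =
      (Real.cos ζ.re + Real.cosh ζ.im) / Real.sinh ζ.im := by
    rw [sinh_conjRadius, cosh_conjRadius hζ]
    ring
  simp only [polar, hsum]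
  apply Complex.ext
  · simp only [discChart_re, sinh_conjRadius]
    field_simp
  · simp only [discChart_im]
    field_simp

theorem dist_discChart (hζ : 0 < ζ.im) {z : ℍ} (hz : (z : ℂ) = discChart w ζ) :
    dist z w = conjRadius ζ.im := by
  rw [discChart_eq_polar w hζ, UpperHalfPlane.coe_inj] at hz
  rw [hz, dist_polar w (conjRadius_pos hζ).le]

theorem hasDerivAt_discChart (w : ℍ) (hζ : 0 < ζ.im) :
    HasDerivAt (discChart w) (w.im / (2 * Complex.cos (ζ / 2) ^ 2)) ζ := by
  have htan := (Complex.hasDerivAt_tan (cos_half_ne_zero hζ)).comp ζ ((hasDerivAt_id ζ).div_const 2)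
  refine ((htan.const_mul (w.im : ℂ)).const_add (w.re : ℂ)).congr_deriv ?_
  field_simp

theorem norm_deriv_discChart (w : ℍ) (hζ : 0 < ζ.im) :
    ‖deriv (discChart w) ζ‖ = w.im / (Real.cos ζ.re + Real.cosh ζ.im) := by
  rw [(hasDerivAt_discChart w hζ).deriv, cos_add_cosh_eq]
  simp [abs_of_pos w.im_pos]

theorem analyticAt_discChart (w : ℍ) (hζ : 0 < ζ.im) : AnalyticAt ℂ (discChart w) ζ :=
  DifferentiableOn.analyticAt (s := {ξ | 0 < ξ.im})
    (fun _ hξ ↦ (hasDerivAt_discChart w hξ).differentiableAt.differentiableWithinAt)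
    ((isOpen_lt continuous_const Complex.continuous_im).mem_nhds hζ)

theorem isConformalChart_discChart (w : ℍ) {R : ℝ} (hR : 0 < R) :
    IsConformalChart (discChart w) (fun s ↦ (Real.sinh s)⁻¹) (conjRadius R)
      (Metric.closedBall w R) where
  analyticAt ζ hζ := analyticAt_discChart w ((conjRadius_pos hR).trans_le hζ)
  mapsTo ζ hζ := by
    have hζ0 : 0 < ζ.im := (conjRadius_pos hR).trans_le hζ
    refine ⟨_, ?_, (discChart_eq_polar w hζ0).symm⟩
    rw [Metric.mem_closedBall, dist_polar w (conjRadius_pos hζ0).le, ← conjRadius_conjRadius R]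
    exact conjRadius_le_conjRadius (conjRadius_pos hR) hζ
  norm_deriv ζ hζ := by
    have hζ0 : 0 < ζ.im := (conjRadius_pos hR).trans_le hζ
    have hsinh := (Real.sinh_pos_iff.mpr hζ0).ne'
    rw [norm_deriv_discChart w hζ0, discChart_im]
    field_simp
  pos s hs := inv_pos.mpr (Real.sinh_pos_iff.mpr ((conjRadius_pos hR).trans_le hs))

theorem discChart_add_two_pi (w : ℍ) (ζ : ℂ) :
    discChart w (ζ + (2 * Real.pi : ℝ)) = discChart w ζ := by
  have hhalf : (ζ + (2 * Real.pi : ℝ)) / 2 = ζ / 2 + Real.pi := by push_cast; ring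
  rw [discChart, hhalf, Complex.tan_periodic]
  rfl

theorem re_arctan_mem_Ioc (z : ℂ) : z.arctan.re ∈ Ioc (-(Real.pi / 2)) (Real.pi / 2) := by
  have hre : z.arctan.re = ((1 + z * Complex.I) / (1 - z * Complex.I)).arg / 2 := by
    rw [Complex.arctan, ← Complex.log_im]
    simp
    ring
  have harg := Complex.arg_mem_Ioc ((1 + z * Complex.I) / (1 - z * Complex.I))
  rw [hre]
  constructor <;> linarith [harg.1, harg.2]

theorem injOn_discChart (w : ℍ) {Y : ℝ} (hY : 0 < Y) :
    InjOn (discChart w) (halfCylinder Real.pi Y) := by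
  have harctan : ∀ ζ ∈ halfCylinder Real.pi Y, (Complex.tan (ζ / 2)).arctan = ζ / 2 := by
    intro ζ hζ
    have hre : (ζ / 2).re = ζ.re / 2 := by simp
    have hζ0 : 0 < ζ.im := hY.trans_le hζ.2
    exact Complex.arctan_tan (fun h ↦ hζ0.ne' (by simpa using congrArg Complex.im h))
      (by linarith [hζ.1.1]) (by linarith [hζ.1.2])
  intro ζ hζ ξ hξ h
  have htan : Complex.tan (ζ / 2) = Complex.tan (ξ / 2) :=
    mul_left_cancel₀ (mod_cast w.im_pos.ne') (add_left_cancel h)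
  have hhalf := harctan ζ hζ
  rw [htan, harctan ξ hξ] at hhalf
  exact ((div_left_inj' two_ne_zero).mp hhalf).symm

theorem exists_discChart_eq {z : ℍ} (hz : z ≠ w) :
    ∃ ζ : ℂ, ζ.re ∈ Ioc (-Real.pi) Real.pi ∧ 0 < ζ.im ∧ discChart w ζ = z := by
  set τ : ℂ := (z - w.re) / w.im with hτ
  have hw : (w.im : ℂ) ≠ 0 := mod_cast w.im_pos.ne'
  have him : τ.im = z.im / w.im := by simp [hτ, Complex.div_ofReal_im]
  have himpos : 0 < τ.im := him ▸ div_pos z.im_pos w.im_pos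
  have hz_eq : (z : ℂ) = w.re + w.im * τ := by rw [hτ]; field_simp; ring
  have hI : τ ≠ Complex.I := fun h ↦ hz <| UpperHalfPlane.ext <| by
    rw [hz_eq, h]
    apply Complex.ext <;> simp
  have hnegI : τ ≠ -Complex.I := fun h ↦ by
    rw [h, Complex.neg_im, Complex.I_im] at himpos
    linarith
  have htan : Complex.tan (2 * τ.arctan / 2) = τ := by
    rw [mul_div_cancel_left₀ _ two_ne_zero, Complex.tan_arctan hI hnegI]
  refine ⟨2 * τ.arctan, ?_, ?_, by rw [discChart, htan, hz_eq]⟩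
  · have hre : (2 * τ.arctan).re = 2 * τ.arctan.re := by simp
    have harctan := re_arctan_mem_Ioc τ
    rw [hre]
    constructor <;> linarith [harctan.1, harctan.2]
  · have him_tan : Real.sinh _ / _ = τ.im := congrArg Complex.im ((tan_half_eq _).symm.trans htan)
    rw [← him_tan, cos_add_cosh_eq] at himpos
    exact Real.sinh_pos_iff.mp (pos_of_mul_pos_left himpos (inv_nonneg.mpr (by positivity)))

theorem coe_image_closedBall_diff (w : ℍ) {R : ℝ} (hR : 0 < R) :
    UpperHalfPlane.coe '' (Metric.closedBall w R \ {w}) =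
      discChart w '' halfCylinder Real.pi (conjRadius R) := by
  apply Subset.antisymm
  · rintro _ ⟨z, ⟨hzR, hzw⟩, rfl⟩
    obtain ⟨ζ, hre, him, hζ⟩ := exists_discChart_eq hzw
    refine ⟨ζ, ⟨hre, ?_⟩, hζ⟩
    rw [Metric.mem_closedBall, dist_discChart him hζ.symm] at hzR
    rw [mem_preimage, mem_Ici, ← conjRadius_conjRadius ζ.im]
    exact conjRadius_le_conjRadius (conjRadius_pos him) hzR
  · rintro _ ⟨ζ, hζ, rfl⟩
    obtain ⟨z, hz, hzζ⟩ := (isConformalChart_discChart w hR).mapsTo hζ.2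
    have hζ0 : 0 < ζ.im := (conjRadius_pos hR).trans_le hζ.2
    refine ⟨z, ⟨hz, dist_pos.mp ?_⟩, hzζ⟩
    rw [dist_discChart hζ0 hzζ]
    exact conjRadius_pos hζ0

end DiscChart

section Circle

variable {𝕜 : Type*} [RCLike 𝕜] {w : ℍ} {R lam : ℝ} {ψ : ℍ → 𝕜}

theorem velocity_periodic {γ : ℝ → ℍ} {T : ℝ} (hγ : Function.Periodic γ T) :
    Function.Periodic (velocity γ) T := fun t ↦ by
  rw [velocity, ← deriv_comp_add_const]
  simp only [hγ _, velocity]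

theorem arclengthIntegral_periodic {γ : ℝ → ℍ} {f : ℝ → ℝ} {T : ℝ} (hγ : Function.Periodic γ T)
    (hf : Function.Periodic f T) (a b : ℝ) :
    arclengthIntegral γ a (a + T) f = arclengthIntegral γ b (b + T) f := by
  refine Function.Periodic.intervalIntegral_add_eq (fun t ↦ ?_) a b
  rw [velocity_periodic hγ, hγ, hf]

theorem restrictedNorm_periodic {K : Set ℍ} {γ : ℝ → ℍ} {T : ℝ} (hγ : Function.Periodic γ T)
    (a b : ℝ) : restrictedNorm K lam ψ γ a (a + T) = restrictedNorm K lam ψ γ b (b + T) := by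
  have hnormal : Function.Periodic (normalDeriv K ψ γ) T := fun t ↦ by
    simp only [normalDeriv, unitNormal, hγ t, velocity_periodic hγ t]
  rw [restrictedNorm, restrictedNorm, arclengthIntegral_periodic hγ (fun t ↦ by rw [hγ]) a b,
    arclengthIntegral_periodic hγ (fun t ↦ by rw [hnormal]) a b]

theorem polar_periodic (w : ℍ) (r : ℝ) : Function.Periodic (polar w r) (2 * Real.pi) := fun θ ↦ by
  simp only [polar, Real.sin_add_two_pi, Real.cos_add_two_pi]

theorem ae_eq_closedBall_diff (w : ℍ) (R : ℝ) :
    (Metric.closedBall w R \ {w} : Set ℍ) =ᵐ[volume] Metric.closedBall w R := by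
  refine sdiff_null_ae_eq_self ?_
  rw [volume_def]
  refine withDensity_absolutelyContinuous _ _ ?_
  rw [measurableEmbedding_coe.comap_apply, image_singleton]
  exact measure_singleton _

theorem exists_norm_fderivWithin_le (hR : 0 < R)
    (hψ : IsEigenfunctionOn (Metric.closedBall w R) lam ψ) :
    ∃ C, ∀ z ∈ UpperHalfPlane.coe '' Metric.closedBall w R,
      ‖fderivWithin ℝ (inCoord ψ) (UpperHalfPlane.coe '' Metric.closedBall w R) z‖ ≤ C := by
  have hball := image_coe_closedBall w R
  have hradius : 0 < w.im * Real.sinh R := mul_pos w.im_pos (Real.sinh_pos_iff.mpr hR)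
  have hunique : UniqueDiffOn ℝ (UpperHalfPlane.coe '' Metric.closedBall w R) := by
    rw [hball]
    refine uniqueDiffOn_convex (convex_closedBall _ _) ?_
    rw [interior_closedBall _ hradius.ne']
    exact Metric.nonempty_ball.mpr hradius
  exact (hball ▸ isCompact_closedBall _ _ : IsCompact (UpperHalfPlane.coe '' _))
    |>.exists_bound_of_continuousOn (hψ.contDiffOn.continuousOn_fderivWithin hunique one_le_two)

theorem tendsto_slice_partialDeriv_discChart (hR : 0 < R)
    (hψ : IsEigenfunctionOn (Metric.closedBall w R) lam ψ) :
    Tendsto (slice Real.pi fun ζ ↦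
      ‖partialDeriv (conjRadius R) (inCoord ψ ∘ discChart w) 1 ζ‖ ^ 2) atTop (𝓝 0) := by
  have hP := isConformalChart_discChart w hR
  obtain ⟨C, hC⟩ := exists_norm_fderivWithin_le hR hψ
  have hbound : Tendsto (fun T ↦ (C * (w.im / (T - 1))) ^ 2 * |Real.pi - -Real.pi|) atTop
      (𝓝 0) := by
    have hdiv : Tendsto (fun T ↦ w.im / (T - 1)) atTop (𝓝 0) :=
      tendsto_const_nhds.div_atTop (tendsto_atTop_add_const_right _ _ tendsto_id)
    simpa using ((hdiv.const_mul C).pow 2).mul_const _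
  refine squeeze_zero_norm' ?_ hbound
  filter_upwards [eventually_ge_atTop (conjRadius R), eventually_gt_atTop 1] with T hT hT1
  refine intervalIntegral.norm_integral_le_of_norm_le_const fun θ _ ↦ ?_
  have hT0 := zero_lt_one.trans hT1
  have hderiv : ‖deriv (discChart w) ⟨θ, T⟩‖ ≤ w.im / (T - 1) := by
    rw [norm_deriv_discChart w hT0]
    refine div_le_div_of_nonneg_left w.im_pos.le (sub_pos.mpr hT1) ?_
    linarith [Real.neg_one_le_cos θ, Real.self_le_sinh_iff.mpr hT0.le, Real.sinh_lt_cosh T]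
  have hD := hC _ (hP.mapsTo (x := ⟨θ, T⟩) hT)
  rw [norm_pow, norm_norm, hP.partialDeriv_comp hψ hT, mul_one]
  gcongr
  exact (ContinuousLinearMap.le_opNorm _ _).trans
    (mul_le_mul hD hderiv (norm_nonneg _) ((norm_nonneg _).trans hD))

theorem restriction_circle (w : ℍ) (hR : 0 < R) (hlam : 0 < lam)
    (hψ : IsEigenfunctionOn (Metric.closedBall w R) lam ψ) :
    IntegrableOn (fun z ↦ Real.cosh (dist z w) * ‖ψ z‖ ^ 2) (Metric.closedBall w R) ∧
      2 / Real.sinh R * ∫ z in Metric.closedBall w R, Real.cosh (dist z w) * ‖ψ z‖ ^ 2 ≤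
        restrictedNorm (Metric.closedBall w R) lam ψ (polar w R) 0 (2 * Real.pi) := by
  have hP := isConformalChart_discChart w hR
  have hS := conjRadius_pos hR
  have hsinh : ∀ s, conjRadius R ≤ s → 0 < Real.sinh s := fun s hs ↦
    Real.sinh_pos_iff.mpr (hS.trans_le hs)
  have hu := hP.isCylinderSolution (p := Real.pi) hψ
    fun ζ _ ↦ congrArg _ (discChart_add_two_pi w ζ)
  obtain ⟨hint, hle⟩ := hP.setIntegral_mul_norm_sq_le hψ hu hlam Real.pi_pos.le
    (fun s hs ↦ (Real.hasDerivAt_sinh s).inv (hsinh s hs).ne')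
    (Real.continuous_cosh.neg.continuousOn.div (Real.continuous_sinh.pow 2).continuousOn
      fun s hs ↦ pow_ne_zero 2 (hsinh s hs).ne')
    (fun s _ ↦ div_nonpos_of_nonpos_of_nonneg (neg_nonpos.mpr (Real.cosh_pos s).le) (sq_nonneg _))
    (fun ε hε ↦ ((tendsto_slice_partialDeriv_discChart hR hψ).eventually_lt_const hε).frequently)
    le_rfl (γ := polar w R)
    (fun θ ↦ by rw [discChart_eq_polar w hS, conjRadius_conjRadius])
    (injOn_discChart w hS) (coe_image_closedBall_diff w hR) (g := fun z ↦ Real.cosh (dist z w))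
    fun ζ hζ ↦ by
      have hζ0 : 0 < ζ.im := hS.trans_le hζ.2
      have := (hsinh _ hζ.2).ne'
      rw [discChart_eq_polar w hζ0, inCoord, ofComplex_apply,
        dist_polar w (conjRadius_pos hζ0).le, cosh_conjRadius hζ0]
      field_simp
  have hperiod := restrictedNorm_periodic (K := Metric.closedBall w R) (lam := lam) (ψ := ψ)
    (polar_periodic w R) (-Real.pi) 0
  rw [zero_add, show -Real.pi + 2 * Real.pi = Real.pi by ring] at hperiod
  rw [setIntegral_congr_set (ae_eq_closedBall_diff w R), hperiod, sinh_conjRadius, inv_inv] at hle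
  refine ⟨hint.congr_set_ae (ae_eq_closedBall_diff w R).symm, ?_⟩
  rwa [div_mul_eq_mul_div, div_le_iff₀' (Real.sinh_pos_iff.mpr hR)]

end Circle

section Bessel

theorem one_add_sq_div_two_le_cosh (s : ℝ) : 1 + s ^ 2 / 2 ≤ Real.cosh s := by
  have hhalf : Real.cosh s = 1 + 2 * Real.sinh (s / 2) ^ 2 := by
    rw [← mul_div_cancel₀ s two_ne_zero, Real.cosh_two_mul, Real.cosh_sq,
      mul_div_cancel₀ s two_ne_zero]
    ring
  have hsinh : (s / 2) ^ 2 ≤ Real.sinh (s / 2) ^ 2 := by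
    rw [sq_le_sq, Real.abs_sinh]
    exact Real.self_le_sinh_iff.mpr (abs_nonneg _)
  linarith

theorem integrable_exp_neg_mul_cosh_mul_cosh_pow (j : ℕ) {a : ℝ} (ha : 0 < a) :
    Integrable fun s ↦ Real.exp (-a * Real.cosh s) * Real.cosh s ^ j := by
  have hcont : Continuous fun s ↦ Real.exp (-a * Real.cosh s) * Real.cosh s ^ j := by fun_prop
  refine (integrable_inv_one_add_sq.const_mul ((j + 2).factorial / a ^ (j + 2))).mono'
    hcont.aestronglyMeasurable (ae_of_all _ fun s ↦ ?_)
  have hexp : a ^ (j + 2) * Real.cosh s ^ (j + 2) ≤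
      Real.exp (a * Real.cosh s) * (j + 2).factorial := by
    rw [← mul_pow, ← div_le_iff₀ (by positivity)]
    exact Real.pow_div_factorial_le_exp _ (by positivity) _
  have hsq : 1 + s ^ 2 ≤ Real.cosh s ^ 2 := by
    nlinarith [one_add_sq_div_two_le_cosh s, sq_nonneg (s ^ 2)]
  rw [Real.norm_of_nonneg (by positivity), neg_mul, Real.exp_neg, ← div_eq_inv_mul,
    ← div_eq_mul_inv, div_div, div_le_div_iff₀ (by positivity) (by positivity)]
  calc Real.cosh s ^ j * (a ^ (j + 2) * (1 + s ^ 2))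
      ≤ Real.cosh s ^ j * (a ^ (j + 2) * Real.cosh s ^ 2) := by gcongr
    _ = a ^ (j + 2) * Real.cosh s ^ (j + 2) := by ring
    _ ≤ (j + 2).factorial * Real.exp (a * Real.cosh s) := by linarith

theorem integrable_exp_neg_mul_cosh_mul {j : ℕ} {a : ℝ} (ha : 0 < a) {f : ℝ → ℝ}
    (hf : Continuous f) (hfj : ∀ s, |f s| ≤ Real.cosh s ^ j) :
    Integrable fun s ↦ Real.exp (-a * Real.cosh s) * f s := by
  have hcont : Continuous fun s ↦ Real.exp (-a * Real.cosh s) * f s := by fun_prop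
  refine (integrable_exp_neg_mul_cosh_mul_cosh_pow j ha).mono' hcont.aestronglyMeasurable
    (ae_of_all _ fun s ↦ ?_)
  rw [norm_mul, Real.norm_of_nonneg (Real.exp_pos _).le]
  exact mul_le_mul_of_nonneg_left (hfj s) (Real.exp_pos _).le

/-- The moment `∫ exp (-a cosh s) cosh^j s cos (t s) ds`; for `j = 0` this is twice the modified
Bessel function `K_{it}(a)`. -/
def besselMoment (t : ℝ) (j : ℕ) (a : ℝ) : ℝ :=
  ∫ s, Real.exp (-a * Real.cosh s) * (Real.cosh s ^ j * Real.cos (t * s))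

variable {a : ℝ}

theorem abs_cosh_pow_mul_cos_le (t : ℝ) (j : ℕ) (s : ℝ) :
    |Real.cosh s ^ j * Real.cos (t * s)| ≤ Real.cosh s ^ j := by
  rw [abs_mul, abs_of_pos (by positivity)]
  exact mul_le_of_le_one_right (by positivity) (Real.abs_cos_le_one _)

theorem integrable_besselMoment (t : ℝ) (j : ℕ) (ha : 0 < a) :
    Integrable fun s ↦ Real.exp (-a * Real.cosh s) * (Real.cosh s ^ j * Real.cos (t * s)) :=
  integrable_exp_neg_mul_cosh_mul ha (by fun_prop) (abs_cosh_pow_mul_cos_le t j)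

theorem hasDerivAt_besselMoment (t : ℝ) (j : ℕ) (ha : 0 < a) :
    HasDerivAt (besselMoment t j) (-besselMoment t (j + 1) a) a := by
  have hmeas (j : ℕ) (b : ℝ) : AEStronglyMeasurable (fun s ↦
      Real.exp (-b * Real.cosh s) * (Real.cosh s ^ j * Real.cos (t * s))) volume :=
    (by fun_prop : Continuous fun s ↦
      Real.exp (-b * Real.cosh s) * (Real.cosh s ^ j * Real.cos (t * s))).aestronglyMeasurable
  have hderiv := (hasDerivAt_integral_of_dominated_loc_of_deriv_le (μ := volume) (x₀ := a)
    (s := Ioi (a / 2)) (Ioi_mem_nhds (by linarith))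
    (F := fun b s ↦ Real.exp (-b * Real.cosh s) * (Real.cosh s ^ j * Real.cos (t * s)))
    (F' := fun b s ↦ -(Real.exp (-b * Real.cosh s) *
      (Real.cosh s ^ (j + 1) * Real.cos (t * s))))
    (bound := fun s ↦ Real.exp (-(a / 2) * Real.cosh s) * Real.cosh s ^ (j + 1))
    (Eventually.of_forall (hmeas j)) (integrable_besselMoment t j ha) (hmeas (j + 1) a).neg
    (ae_of_all _ fun s b hb ↦ ?_)
    (integrable_exp_neg_mul_cosh_mul_cosh_pow (j + 1) (by positivity))
    (ae_of_all _ fun s b _ ↦ ?_)).2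
  · rwa [integral_neg] at hderiv
  · rw [norm_neg, norm_mul, Real.norm_of_nonneg (by positivity)]
    refine mul_le_mul ?_ (abs_cosh_pow_mul_cos_le t _ s) (by positivity) (by positivity)
    have hab : a / 2 ≤ b := hb.le
    gcongr
  · refine (((hasDerivAt_neg b).mul_const (Real.cosh s)).exp.mul_const _).congr_deriv ?_
    ring

theorem integral_quadratic_cosh (t : ℝ) (ha : 0 < a) (c₀ c₁ c₂ : ℝ) :
    (Integrable fun s ↦ Real.exp (-a * Real.cosh s) *
      ((c₀ + c₁ * Real.cosh s + c₂ * Real.cosh s ^ 2) * Real.cos (t * s))) ∧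
    ∫ s, Real.exp (-a * Real.cosh s) *
      ((c₀ + c₁ * Real.cosh s + c₂ * Real.cosh s ^ 2) * Real.cos (t * s)) =
      c₀ * besselMoment t 0 a + c₁ * besselMoment t 1 a + c₂ * besselMoment t 2 a := by
  have hint (c : ℝ) (j : ℕ) := (integrable_besselMoment t j ha).const_mul c
  have hsum : (fun s ↦ Real.exp (-a * Real.cosh s) *
      ((c₀ + c₁ * Real.cosh s + c₂ * Real.cosh s ^ 2) * Real.cos (t * s))) = fun s ↦
      c₀ * (Real.exp (-a * Real.cosh s) * (Real.cosh s ^ 0 * Real.cos (t * s))) +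
      c₁ * (Real.exp (-a * Real.cosh s) * (Real.cosh s ^ 1 * Real.cos (t * s))) +
      c₂ * (Real.exp (-a * Real.cosh s) * (Real.cosh s ^ 2 * Real.cos (t * s))) := by
    ext s; ring
  rw [hsum]
  refine ⟨((hint c₀ 0).fun_add (hint c₁ 1)).fun_add (hint c₂ 2), ?_⟩
  rw [integral_add ((hint c₀ 0).fun_add (hint c₁ 1)) (hint c₂ 2),
    integral_add (hint c₀ 0) (hint c₁ 1), integral_const_mul, integral_const_mul,
    integral_const_mul]
  rfl

theorem besselMoment_ode (t : ℝ) (ha : 0 < a) :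
    a ^ 2 * besselMoment t 2 a = (a ^ 2 - t ^ 2) * besselMoment t 0 a + a * besselMoment t 1 a := by
  have hderiv (s : ℝ) : HasDerivAt (fun s ↦ Real.exp (-a * Real.cosh s) *
      (t * Real.sin (t * s) - a * (Real.sinh s * Real.cos (t * s))))
      (Real.exp (-a * Real.cosh s) *
        (((t ^ 2 - a ^ 2) + -a * Real.cosh s + a ^ 2 * Real.cosh s ^ 2) * Real.cos (t * s))) s := by
    have hexp := ((Real.hasDerivAt_cosh s).const_mul (-a)).exp
    have hlin : HasDerivAt (fun s ↦ t * s) t s := hasDerivAt_const_mul t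
    refine (hexp.fun_mul ((hlin.sin.const_mul t).fun_sub
      (((Real.hasDerivAt_sinh s).fun_mul hlin.cos).const_mul a))).congr_deriv ?_
    linear_combination
      (-(a ^ 2) * Real.exp (-a * Real.cosh s) * Real.cos (t * s)) * Real.cosh_sq s
  have hsin : Integrable fun s ↦ Real.exp (-a * Real.cosh s) * Real.sin (t * s) :=
    integrable_exp_neg_mul_cosh_mul (j := 0) ha (by fun_prop) fun s ↦ by
      simpa using Real.abs_sin_le_one _
  have hsinh : Integrable fun s ↦ Real.exp (-a * Real.cosh s) *
      (Real.sinh s * Real.cos (t * s)) :=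
    integrable_exp_neg_mul_cosh_mul (j := 1) ha (by fun_prop) fun s ↦ by
      rw [abs_mul, pow_one, Real.abs_sinh, ← Real.cosh_abs]
      exact (mul_le_of_le_one_right (Real.sinh_nonneg_iff.mpr (abs_nonneg _))
        (Real.abs_cos_le_one _)).trans (Real.sinh_lt_cosh _).le
  have hprimitive : Integrable fun s ↦ Real.exp (-a * Real.cosh s) *
      (t * Real.sin (t * s) - a * (Real.sinh s * Real.cos (t * s))) :=
    ((hsin.const_mul t).sub (hsinh.const_mul a)).congr (ae_of_all _ fun s ↦ by
      simp only [Pi.sub_apply]; ring)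
  obtain ⟨hint, heq⟩ := integral_quadratic_cosh t ha (t ^ 2 - a ^ 2) (-a) (a ^ 2)
  have hzero := heq ▸ integral_eq_zero_of_hasDerivAt_of_integrable hderiv hint hprimitive
  linarith

theorem besselMoment_zero_zero_pos (ha : 0 < a) : 0 < besselMoment 0 0 a := by
  have hint := integrable_besselMoment 0 0 ha
  simp only [besselMoment, pow_zero, zero_mul, Real.cos_zero, mul_one] at hint ⊢
  exact integral_exp_pos hint

theorem two_mul_sub_one_mul_besselMoment_one_le (ha : 0 < a) :
    (2 * a - 1) * besselMoment 0 1 a ≤ 2 * a * besselMoment 0 0 a := by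
  have hsq : 0 ≤ 1 * besselMoment 0 0 a + -2 * besselMoment 0 1 a + 1 * besselMoment 0 2 a := by
    rw [← (integral_quadratic_cosh 0 ha 1 (-2) 1).2]
    refine integral_nonneg fun s ↦ mul_nonneg (Real.exp_pos _).le ?_
    rw [zero_mul, Real.cos_zero]
    nlinarith [sq_nonneg (Real.cosh s - 1)]
  nlinarith [besselMoment_ode 0 ha, mul_nonneg ha.le hsq]

theorem le_besselMoment_zero (t : ℝ) (ha : 0 < a) :
    (1 + t ^ 2) * besselMoment 0 0 a - t ^ 2 * besselMoment 0 1 a ≤ besselMoment t 0 a := by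
  obtain ⟨hint, heq⟩ := integral_quadratic_cosh 0 ha (1 + t ^ 2) (-t ^ 2) 0
  calc (1 + t ^ 2) * besselMoment 0 0 a - t ^ 2 * besselMoment 0 1 a
      = ∫ s, Real.exp (-a * Real.cosh s) *
          (((1 + t ^ 2) + -t ^ 2 * Real.cosh s + 0 * Real.cosh s ^ 2) * Real.cos (0 * s)) := by
        rw [heq]; ring
    _ ≤ besselMoment t 0 a := by
        refine integral_mono hint (integrable_besselMoment t 0 ha) fun s ↦
          mul_le_mul_of_nonneg_left ?_ (Real.exp_pos _).le
        rw [zero_mul, zero_mul, Real.cos_zero, add_zero, mul_one, pow_zero, one_mul]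
        have hcos : 1 - (t * s) ^ 2 / 2 ≤ Real.cos (t * s) := Real.one_sub_sq_div_two_le_cos
        nlinarith [mul_le_mul_of_nonneg_left (one_add_sq_div_two_le_cosh s) (sq_nonneg t)]

theorem besselMoment_zero_pos {t : ℝ} (ht : t ^ 2 < 2 * a - 1) : 0 < besselMoment t 0 a := by
  have hgap : 0 < 2 * a - 1 := (sq_nonneg t).trans_lt ht
  have ha : 0 < a := by linarith
  refine pos_of_mul_pos_right ?_ hgap.le
  calc 0 < (2 * a - 1 - t ^ 2) * besselMoment 0 0 a :=
        mul_pos (sub_pos.mpr ht) (besselMoment_zero_zero_pos ha)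
    _ = (2 * a - 1) * ((1 + t ^ 2) * besselMoment 0 0 a) -
          t ^ 2 * (2 * a * besselMoment 0 0 a) := by ring
    _ ≤ (2 * a - 1) * ((1 + t ^ 2) * besselMoment 0 0 a) -
          t ^ 2 * ((2 * a - 1) * besselMoment 0 1 a) := by
        exact sub_le_sub_left (mul_le_mul_of_nonneg_left
          (two_mul_sub_one_mul_besselMoment_one_le ha) (sq_nonneg t)) _
    _ = (2 * a - 1) * ((1 + t ^ 2) * besselMoment 0 0 a - t ^ 2 * besselMoment 0 1 a) := by ring
    _ ≤ (2 * a - 1) * besselMoment t 0 a := by gcongr; exact le_besselMoment_zero t ha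

theorem abs_besselMoment_le (t : ℝ) (j : ℕ) (ha : 1 ≤ a) :
    |besselMoment t j a| ≤ Real.exp (-(a - 1)) * besselMoment 0 j 1 := by
  rw [← Real.norm_eq_abs, besselMoment, besselMoment, ← integral_const_mul]
  refine norm_integral_le_of_norm_le ((integrable_besselMoment 0 j one_pos).const_mul _)
    (ae_of_all _ fun s ↦ ?_)
  rw [norm_mul, Real.norm_of_nonneg (Real.exp_pos _).le, zero_mul, Real.cos_zero, mul_one,
    ← mul_assoc, ← Real.exp_add]
  refine mul_le_mul (Real.exp_le_exp.mpr ?_) (abs_cosh_pow_mul_cos_le t j s) (by positivity)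
    (by positivity)
  nlinarith [Real.one_le_cosh s]

theorem tendsto_sqrt_mul_besselMoment (t : ℝ) (j : ℕ) {k : ℝ} (hk : 0 < k) :
    Tendsto (fun y ↦ √y * besselMoment t j (k * y)) atTop (𝓝 0) := by
  have hdecay := (tendsto_rpow_mul_exp_neg_mul_atTop_nhds_zero (1 / 2) k hk).mul_const
    (Real.exp 1 * besselMoment 0 j 1)
  rw [zero_mul] at hdecay
  refine squeeze_zero_norm' ?_ hdecay
  filter_upwards [eventually_ge_atTop (1 / k)] with y hy
  have hky : 1 ≤ k * y := by rwa [div_le_iff₀' hk] at hy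
  calc ‖√y * besselMoment t j (k * y)‖ = √y * |besselMoment t j (k * y)| := by
        rw [norm_mul, Real.norm_of_nonneg (Real.sqrt_nonneg _), Real.norm_eq_abs]
    _ ≤ √y * (Real.exp (-(k * y - 1)) * besselMoment 0 j 1) := by
        gcongr; exact abs_besselMoment_le t j hky
    _ = y ^ (1 / 2 : ℝ) * Real.exp (-k * y) * (Real.exp 1 * besselMoment 0 j 1) := by
        rw [← Real.sqrt_eq_rpow, show -(k * y - 1) = -k * y + 1 by ring, Real.exp_add]
        ring

end Bessel

section DecayingMode

/-- `u` is a decaying and eventually positive solution of `u'' = (k² - lam / y²) u` on the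
half-line `y > 0`, and `v` is its derivative; then `u(y) cos (k x)` is an eigenfunction of the
hyperbolic Laplacian with eigenvalue `lam`. -/
structure IsDecayingMode (k lam : ℝ) (u v : ℝ → ℝ) : Prop where
  hasDerivAt : ∀ y, 0 < y → HasDerivAt u (v y) y
  hasDerivAt_deriv : ∀ y, 0 < y → HasDerivAt v ((k ^ 2 - lam / y ^ 2) * u y) y
  tendsto : Tendsto u atTop (𝓝 0)
  tendsto_deriv : Tendsto v atTop (𝓝 0)
  pos : ∀ᶠ y in atTop, 0 < u y

/-- The energy `u'² + (lam / y² - k²) u²` of a solution of `u'' = (k² - lam / y²) u`, with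
`v = u'`. -/
def modeEnergy (k lam : ℝ) (u v : ℝ → ℝ) (y : ℝ) : ℝ :=
  v y ^ 2 + (lam / y ^ 2 - k ^ 2) * u y ^ 2

variable {k lam a b y Y : ℝ} {u v : ℝ → ℝ}

theorem mul_sq_le_two_mul_energy (hy : 0 < y) (hlam : 2 * k ^ 2 * y ^ 2 ≤ lam) :
    lam * u y ^ 2 ≤ 2 * y ^ 2 * modeEnergy k lam u v y := by
  have hexpand : 2 * y ^ 2 * modeEnergy k lam u v y =
      2 * (y * v y) ^ 2 + (lam + (lam - 2 * k ^ 2 * y ^ 2)) * u y ^ 2 := by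
    rw [modeEnergy]; field_simp; ring
  nlinarith [mul_nonneg (sub_nonneg.mpr hlam) (sq_nonneg (u y)), sq_nonneg (y * v y)]

theorem two_mul_mul_abs_le_energy {σ : ℝ} (hy : 0 < y) (hlam : (k ^ 2 + σ ^ 2) * y ^ 2 ≤ lam) :
    2 * σ * |u y * v y| ≤ modeEnergy k lam u v y := by
  have hpotential : σ ^ 2 ≤ lam / y ^ 2 - k ^ 2 := by
    rw [le_sub_iff_add_le', le_div_iff₀ (by positivity)]
    exact hlam
  calc 2 * σ * |u y * v y| ≤ |v y| ^ 2 + σ ^ 2 * |u y| ^ 2 := by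
        rw [abs_mul]; nlinarith [sq_nonneg (|v y| - σ * |u y|)]
    _ = v y ^ 2 + σ ^ 2 * u y ^ 2 := by rw [sq_abs, sq_abs]
    _ ≤ modeEnergy k lam u v y := by unfold modeEnergy; gcongr

namespace IsDecayingMode

theorem hasDerivAt_energy (h : IsDecayingMode k lam u v) (hy : 0 < y) :
    HasDerivAt (modeEnergy k lam u v) (-(2 * lam / y ^ 3 * u y ^ 2)) y := by
  have hpotential := ((hasDerivAt_const y lam).fun_div (hasDerivAt_pow 2 y)
    (pow_ne_zero 2 hy.ne')).sub_const (k ^ 2)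
  refine (((h.hasDerivAt_deriv y hy).fun_pow 2).fun_add
    (hpotential.fun_mul ((h.hasDerivAt y hy).fun_pow 2))).congr_deriv ?_
  field_simp
  push_cast
  ring

theorem continuousOn (h : IsDecayingMode k lam u v) (ha : 0 < a) : ContinuousOn u (Icc a b) :=
  fun y hy ↦ (h.hasDerivAt y (ha.trans_le hy.1)).continuousAt.continuousWithinAt

theorem continuousOn_deriv (h : IsDecayingMode k lam u v) (ha : 0 < a) :
    ContinuousOn v (Icc a b) :=
  fun y hy ↦ (h.hasDerivAt_deriv y (ha.trans_le hy.1)).continuousAt.continuousWithinAt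

theorem tendsto_energy (h : IsDecayingMode k lam u v) :
    Tendsto (modeEnergy k lam u v) atTop (𝓝 0) := by
  have hpotential : Tendsto (fun y : ℝ ↦ lam / y ^ 2 - k ^ 2) atTop (𝓝 (0 - k ^ 2)) :=
    (tendsto_const_nhds.div_atTop (tendsto_pow_atTop two_ne_zero)).sub_const _
  have hlim := (h.tendsto_deriv.pow 2).add (hpotential.mul (h.tendsto.pow 2))
  simp only [ne_eq, OfNat.ofNat_ne_zero, not_false_eq_true, zero_pow, mul_zero, add_zero] at hlim
  exact hlim

theorem antitoneOn_energy (h : IsDecayingMode k lam u v) (hlam : 0 ≤ lam) :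
    AntitoneOn (modeEnergy k lam u v) (Ioi 0) := by
  refine antitoneOn_of_hasDerivWithinAt_nonpos (convex_Ioi 0)
    (fun y hy ↦ (h.hasDerivAt_energy hy).continuousAt.continuousWithinAt)
    (fun y hy ↦ (h.hasDerivAt_energy (interior_subset hy)).hasDerivWithinAt) fun y hy ↦ ?_
  have hy0 : 0 < y := interior_subset hy
  exact neg_nonpos.mpr (by positivity)

theorem energy_nonneg (h : IsDecayingMode k lam u v) (hlam : 0 ≤ lam) (hy : 0 < y) :
    0 ≤ modeEnergy k lam u v y := by
  refine le_of_tendsto h.tendsto_energy ?_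
  filter_upwards [eventually_ge_atTop y] with z hz
  exact h.antitoneOn_energy hlam hy (hy.trans_le hz) hz

theorem energy_pos (h : IsDecayingMode k lam u v) (hlam : 0 < lam) (hy : 0 < y) :
    0 < modeEnergy k lam u v y := by
  refine (h.energy_nonneg hlam.le hy).lt_of_ne' fun hzero ↦ ?_
  obtain ⟨z, hz, hyz⟩ := (h.pos.and (eventually_gt_atTop y)).exists
  have hvanish : modeEnergy k lam u v =ᶠ[𝓝 z] fun _ ↦ 0 := by
    filter_upwards [Ioi_mem_nhds hyz] with x hx
    have hx0 : 0 < x := hy.trans hx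
    exact le_antisymm (hzero ▸ h.antitoneOn_energy hlam.le hy hx0 (le_of_lt hx))
      (h.energy_nonneg hlam.le hx0)
  have hz0 := hy.trans hyz
  have hderiv := ((hasDerivAt_const z (0 : ℝ)).congr_of_eventuallyEq hvanish).unique
    (h.hasDerivAt_energy hz0)
  have hpos : 0 < 2 * lam / z ^ 3 * u z ^ 2 := by positivity
  linarith

theorem integral_energy (h : IsDecayingMode k lam u v) (hlam : 0 ≤ lam) (hY : 0 < Y) :
    IntegrableOn (fun y ↦ 2 * lam / y ^ 3 * u y ^ 2) (Ioi Y) ∧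
      ∫ y in Ioi Y, 2 * lam / y ^ 3 * u y ^ 2 = modeEnergy k lam u v Y := by
  have hderiv : ∀ y ∈ Ioi Y, HasDerivAt (modeEnergy k lam u v) (-(2 * lam / y ^ 3 * u y ^ 2)) y :=
    fun y hy ↦ h.hasDerivAt_energy (hY.trans hy)
  have hcont : ContinuousWithinAt (modeEnergy k lam u v) (Ici Y) Y :=
    (h.hasDerivAt_energy hY).continuousAt.continuousWithinAt
  have hnonpos : ∀ y ∈ Ioi Y, -(2 * lam / y ^ 3 * u y ^ 2) ≤ 0 := fun y hy ↦ by
    have hy0 : 0 < y := hY.trans hy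
    exact neg_nonpos.mpr (by positivity)
  have hint := integrableOn_Ioi_deriv_of_nonpos hcont hderiv hnonpos h.tendsto_energy
  have heq := integral_Ioi_of_hasDerivAt_of_nonpos hcont hderiv hnonpos h.tendsto_energy
  rw [integral_neg] at heq
  exact ⟨by simpa using hint.neg, by linarith⟩

theorem energy_le (h : IsDecayingMode k lam u v) (hY : 0 < Y) (hYb : Y ≤ b)
    (hlamb : 2 * k ^ 2 * b ^ 2 ≤ lam) :
    modeEnergy k lam u v Y ≤ (b / Y) ^ 4 * modeEnergy k lam u v b := by
  have hderiv (y : ℝ) (hy : 0 < y) : HasDerivAt (fun y ↦ y ^ 4 * modeEnergy k lam u v y)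
      (4 * y ^ 3 * modeEnergy k lam u v y - 2 * y * (lam * u y ^ 2)) y := by
    refine ((hasDerivAt_pow 4 y).fun_mul (h.hasDerivAt_energy hy)).congr_deriv ?_
    field_simp
    push_cast
    ring
  have hmono : MonotoneOn (fun y ↦ y ^ 4 * modeEnergy k lam u v y) (Icc Y b) := by
    refine monotoneOn_of_hasDerivWithinAt_nonneg (convex_Icc Y b)
      (fun y hy ↦ (hderiv y (hY.trans_le hy.1)).continuousAt.continuousWithinAt)
      (fun y hy ↦ (hderiv y (hY.trans_le (interior_subset hy).1)).hasDerivWithinAt) fun y hy ↦ ?_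
    obtain ⟨hYy, hyb⟩ := interior_subset hy
    have hy0 : 0 < y := hY.trans_le hYy
    have hlamy : 2 * k ^ 2 * y ^ 2 ≤ lam := le_trans (by gcongr) hlamb
    nlinarith [mul_le_mul_of_nonneg_left
      (mul_sq_le_two_mul_energy (u := u) (v := v) hy0 hlamy) hy0.le]
  rw [div_pow, div_mul_eq_mul_div, le_div_iff₀ (by positivity), mul_comm]
  exact hmono (left_mem_Icc.mpr hYb) (right_mem_Icc.mpr hYb) hYb

/-- Equipartition: kinetic and potential energy differ on `[a, b]` by a boundary term. -/
theorem energy_le_mass_add (h : IsDecayingMode k lam u v) (hlam : 0 ≤ lam) (ha : 0 < a)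
    (hab : a ≤ b) : (b - a) * modeEnergy k lam u v b ≤
      2 * lam * (∫ y in a..b, u y ^ 2 / y ^ 2) + (u b * v b - u a * v a) := by
  have hpos : ∀ y ∈ Icc a b, 0 < y := fun y hy ↦ ha.trans_le hy.1
  have hint {f : ℝ → ℝ} (hf : ContinuousOn f (Icc a b)) : IntervalIntegrable f volume a b :=
    ContinuousOn.intervalIntegrable (by rwa [uIcc_of_le hab])
  have hu := h.continuousOn (b := b) ha
  have hv := h.continuousOn_deriv (b := b) ha
  have hmass : IntervalIntegrable (fun y ↦ 2 * lam * (u y ^ 2 / y ^ 2)) volume a b :=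
    (hint ((hu.pow 2).div (continuousOn_id.pow 2) fun y hy ↦
      pow_ne_zero 2 (hpos y hy).ne')).const_mul (2 * lam)
  have hpotential : ContinuousOn (fun y ↦ k ^ 2 - lam / y ^ 2) (Icc a b) :=
    continuousOn_const.sub (continuousOn_const.div (continuousOn_id.pow 2) fun y hy ↦
      pow_ne_zero 2 (hpos y hy).ne')
  have hboundary : IntervalIntegrable
      (fun y ↦ v y * v y + u y * ((k ^ 2 - lam / y ^ 2) * u y)) volume a b :=
    hint ((hv.mul hv).add (hu.mul (hpotential.mul hu)))
  calc (b - a) * modeEnergy k lam u v b = ∫ _ in a..b, modeEnergy k lam u v b := by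
        rw [intervalIntegral.integral_const, smul_eq_mul]
    _ ≤ ∫ y in a..b, (2 * lam * (u y ^ 2 / y ^ 2) +
          (v y * v y + u y * ((k ^ 2 - lam / y ^ 2) * u y))) := by
        refine intervalIntegral.integral_mono_on hab intervalIntegrable_const
          (hmass.add hboundary) fun y hy ↦ ?_
        refine (h.antitoneOn_energy hlam (hpos y hy) (ha.trans_le hab) hy.2).trans ?_
        have hdiff : 2 * lam * (u y ^ 2 / y ^ 2) + (v y * v y +
            u y * ((k ^ 2 - lam / y ^ 2) * u y)) - modeEnergy k lam u v y = 2 * (k * u y) ^ 2 := by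
          rw [modeEnergy]; ring
        nlinarith [sq_nonneg (k * u y)]
    _ = 2 * lam * (∫ y in a..b, u y ^ 2 / y ^ 2) + (u b * v b - u a * v a) := by
        rw [intervalIntegral.integral_add hmass hboundary, intervalIntegral.integral_const_mul,
          intervalIntegral.integral_eq_sub_of_hasDerivAt (f := fun y ↦ u y * v y) (fun y hy ↦ ?_)
            hboundary]
        rw [uIcc_of_le hab] at hy
        exact (h.hasDerivAt y (hpos y hy)).fun_mul (h.hasDerivAt_deriv y (hpos y hy))

theorem mass_ge (h : IsDecayingMode k lam u v) (ha : 0 < a) (hab : a < b)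
    (hlamk : 2 * k ^ 2 * b ^ 2 ≤ lam) (hlamσ : 2 * (2 * (b / a) ^ 4 / (b - a)) ^ 2 * b ^ 2 ≤ lam) :
    (b - a) / 4 * modeEnergy k lam u v b ≤ lam * ∫ y in a..b, u y ^ 2 / y ^ 2 := by
  have hb : 0 < b := ha.trans hab
  have hba : 0 < b - a := sub_pos.mpr hab
  have hlam : 0 ≤ lam := le_trans (by positivity) hlamk
  set σ := 2 * (b / a) ^ 4 / (b - a) with hσ
  have hσ0 : 0 < σ := by positivity
  set E := modeEnergy k lam u v
  have hcross (y : ℝ) (hay : a ≤ y) (hyb : y ≤ b) : 2 * σ * |u y * v y| ≤ (b / a) ^ 4 * E b := by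
    have hy0 := ha.trans_le hay
    have hlamy : (k ^ 2 + σ ^ 2) * y ^ 2 ≤ lam :=
      (mul_le_mul_of_nonneg_left (pow_le_pow_left₀ hy0.le hyb 2) (by positivity)).trans
        (by linarith)
    exact (two_mul_mul_abs_le_energy hy0 hlamy).trans
      ((h.antitoneOn_energy hlam ha hy0 hay).trans (h.energy_le ha hab.le hlamk))
  have hboundary : u b * v b - u a * v a ≤ (b - a) / 2 * E b := by
    refine le_of_mul_le_mul_left (a := 2 * σ) ?_ (mul_pos two_pos hσ0)
    calc 2 * σ * (u b * v b - u a * v a) ≤ 2 * σ * (|u b * v b| + |u a * v a|) := by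
          gcongr; linarith [le_abs_self (u b * v b), neg_abs_le (u a * v a)]
      _ ≤ 2 * ((b / a) ^ 4 * E b) := by
          linarith [hcross b hab.le le_rfl, hcross a le_rfl hab.le]
      _ = 2 * σ * ((b - a) / 2 * E b) := by rw [hσ]; field_simp
  linarith [h.energy_le_mass_add hlam ha hab.le]

theorem integral_excess_le (h : IsDecayingMode k lam u v) (hlam : 0 < lam) {α : ℝ} {G : ℝ → ℝ}
    (hY : 0 < Y) (hint : IntegrableOn (fun y ↦ u y ^ 2 * G y * (y ^ 2)⁻¹) (Ioi Y))
    (hle : 2 * α * ∫ y in Ioi Y, u y ^ 2 * G y * (y ^ 2)⁻¹ ≤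
      Y⁻¹ * u Y ^ 2 + lam⁻¹ * (Y * v Y ^ 2)) :
    IntegrableOn (fun y ↦ 2 * lam * (u y ^ 2 / y ^ 2) * (α * G y - Y * y⁻¹)) (Ioi Y) ∧
      ∫ y in Ioi Y, 2 * lam * (u y ^ 2 / y ^ 2) * (α * G y - Y * y⁻¹) ≤ Y * k ^ 2 * u Y ^ 2 := by
  obtain ⟨henergy, heq⟩ := h.integral_energy hlam.le hY
  have hsplit : ∀ y ∈ Ioi Y, 2 * lam * α * (u y ^ 2 * G y * (y ^ 2)⁻¹) -
      Y * (2 * lam / y ^ 3 * u y ^ 2) = 2 * lam * (u y ^ 2 / y ^ 2) * (α * G y - Y * y⁻¹) :=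
    fun y hy ↦ by
      have hy0 : 0 < y := hY.trans hy
      field_simp
  refine ⟨IntegrableOn.congr_fun ((hint.const_mul (2 * lam * α)).sub' (henergy.const_mul Y))
    hsplit measurableSet_Ioi, ?_⟩
  rw [← setIntegral_congr_fun measurableSet_Ioi hsplit,
    integral_sub (hint.const_mul _) (henergy.const_mul _), integral_const_mul, integral_const_mul,
    heq]
  have hboundary : lam * (Y⁻¹ * u Y ^ 2 + lam⁻¹ * (Y * v Y ^ 2)) =
      Y * modeEnergy k lam u v Y + Y * k ^ 2 * u Y ^ 2 := by
    rw [modeEnergy]; field_simp; ring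
  linarith [mul_le_mul_of_nonneg_left hle hlam.le]

theorem weighted_mass_le (h : IsDecayingMode k lam u v) (hlam : 0 < lam) {c α : ℝ} {G : ℝ → ℝ}
    (hY : 0 < Y) (hYa : Y ≤ a) (hab : a ≤ b)
    (hint : IntegrableOn (fun y ↦ u y ^ 2 * G y * (y ^ 2)⁻¹) (Ioi Y))
    (hle : 2 * α * ∫ y in Ioi Y, u y ^ 2 * G y * (y ^ 2)⁻¹ ≤
      Y⁻¹ * u Y ^ 2 + lam⁻¹ * (Y * v Y ^ 2))
    (hw : ∀ y, Y ≤ y → Y * y⁻¹ ≤ α * G y) (hc : ∀ y ∈ Icc a b, c ≤ α * G y - Y * y⁻¹) :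
    2 * lam * c * ∫ y in a..b, u y ^ 2 / y ^ 2 ≤ Y * k ^ 2 * u Y ^ 2 := by
  obtain ⟨hexcess, hbound⟩ := h.integral_excess_le hlam hY hint hle
  have ha : 0 < a := hY.trans_le hYa
  have hsub : Ioc a b ⊆ Ioi Y := fun y hy ↦ hYa.trans_lt hy.1
  have hmass : IntegrableOn (fun y ↦ u y ^ 2 / y ^ 2) (Ioc a b) :=
    (((h.continuousOn ha).pow 2).div (continuousOn_id.pow 2) fun y hy ↦
      pow_ne_zero 2 (ha.trans_le hy.1).ne').integrableOn_Icc.mono_set Ioc_subset_Icc_self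
  calc 2 * lam * c * ∫ y in a..b, u y ^ 2 / y ^ 2
      = ∫ y in Ioc a b, 2 * lam * c * (u y ^ 2 / y ^ 2) := by
        rw [intervalIntegral.integral_of_le hab, integral_const_mul]
    _ ≤ ∫ y in Ioc a b, 2 * lam * (u y ^ 2 / y ^ 2) * (α * G y - Y * y⁻¹) := by
        refine setIntegral_mono_on (hmass.const_mul _) (hexcess.mono_set hsub) measurableSet_Ioc
          fun y hy ↦ ?_
        rw [mul_right_comm]
        exact mul_le_mul_of_nonneg_left (hc y (Ioc_subset_Icc_self hy)) (by positivity)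
    _ ≤ ∫ y in Ioi Y, 2 * lam * (u y ^ 2 / y ^ 2) * (α * G y - Y * y⁻¹) := by
        refine setIntegral_mono_set hexcess ?_ hsub.eventuallyLE
        filter_upwards [ae_restrict_mem measurableSet_Ioi] with y hy
        exact mul_nonneg (by positivity) (sub_nonneg.mpr (hw y (le_of_lt hy)))
    _ ≤ Y * k ^ 2 * u Y ^ 2 := hbound

end IsDecayingMode

theorem eventually_forall_lt_mass (k : ℝ) {c : ℝ} (hY : 0 < Y) (hYa : Y ≤ a) (hab : a < b)
    (hc : 0 < c) : ∀ᶠ lam in atTop, ∀ u v : ℝ → ℝ, IsDecayingMode k lam u v →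
      Y * k ^ 2 * u Y ^ 2 < 2 * lam * c * ∫ y in a..b, u y ^ 2 / y ^ 2 := by
  have : 0 < b - a := sub_pos.mpr hab
  have hYb : Y ≤ b := hYa.trans hab.le
  have hb : 0 < b := hY.trans_le hYb
  filter_upwards [eventually_gt_atTop 0, eventually_ge_atTop (2 * k ^ 2 * b ^ 2),
    eventually_ge_atTop (2 * (2 * (b / a) ^ 4 / (b - a)) ^ 2 * b ^ 2),
    eventually_gt_atTop (4 * Y ^ 3 * k ^ 2 * (b / Y) ^ 4 / (c * (b - a)))]
    with lam hlam hlamk hlamσ hlamc u v h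
  have hlamY : 2 * k ^ 2 * Y ^ 2 ≤ lam := le_trans (by gcongr) hlamk
  rw [div_lt_iff₀ (by positivity)] at hlamc
  refine lt_of_mul_lt_mul_left (a := lam) ?_ hlam.le
  calc lam * (Y * k ^ 2 * u Y ^ 2) = Y * k ^ 2 * (lam * u Y ^ 2) := by ring
    _ ≤ Y * k ^ 2 * (2 * Y ^ 2 * ((b / Y) ^ 4 * modeEnergy k lam u v b)) := by
        refine mul_le_mul_of_nonneg_left
          ((mul_sq_le_two_mul_energy (v := v) hY hlamY).trans ?_) (by positivity)
        gcongr
        exact h.energy_le hY hYb hlamk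
    _ = 4 * Y ^ 3 * k ^ 2 * (b / Y) ^ 4 * (modeEnergy k lam u v b / 2) := by ring
    _ < lam * (c * (b - a)) * (modeEnergy k lam u v b / 2) := by
        have hE := h.energy_pos hlam hb
        gcongr
    _ = 2 * lam * c * ((b - a) / 4 * modeEnergy k lam u v b) := by ring
    _ ≤ 2 * lam * c * (lam * ∫ y in a..b, u y ^ 2 / y ^ 2) := by
        exact mul_le_mul_of_nonneg_left (h.mass_ge (hY.trans_le hYa) hab hlamk hlamσ)
          (by positivity)
    _ = lam * (2 * lam * c * ∫ y in a..b, u y ^ 2 / y ^ 2) := by ring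

theorem hasDerivAt_deriv_sqrt_mul_besselMoment (t : ℝ) (hk : 0 < k) (hy : 0 < y) :
    HasDerivAt
      (fun y ↦ 1 / (2 * √y) * besselMoment t 0 (k * y) - √y * besselMoment t 1 (k * y) * k)
      ((k ^ 2 - (1 / 4 + t ^ 2) / y ^ 2) * (√y * besselMoment t 0 (k * y))) y := by
  have hmoment (j : ℕ) :=
    (hasDerivAt_besselMoment t j (mul_pos hk hy)).comp y (hasDerivAt_const_mul k)
  have hsqrt := Real.hasDerivAt_sqrt hy.ne'
  have hinv := (hasDerivAt_const y (1 : ℝ)).fun_div (hsqrt.const_mul 2)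
    (mul_ne_zero two_ne_zero (Real.sqrt_pos.mpr hy).ne')
  refine ((hinv.fun_mul (hmoment 0)).fun_sub
    ((hsqrt.fun_mul (hmoment 1)).mul_const k)).congr_deriv ?_
  have hode := besselMoment_ode t (mul_pos hk hy)
  have hr : 0 < √y := Real.sqrt_pos.mpr hy
  have hy2 : y = √y ^ 2 := (Real.sq_sqrt hy.le).symm
  simp only [Function.comp, zero_add, Nat.reduceAdd]
  generalize besselMoment t 0 (k * y) = b₀ at *
  generalize besselMoment t 1 (k * y) = b₁ at *
  generalize besselMoment t 2 (k * y) = b₂ at *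
  generalize √y = r at *
  subst hy2
  field_simp
  linear_combination 16 * hode

theorem isDecayingMode_bessel (t : ℝ) (hk : 0 < k) :
    IsDecayingMode k (1 / 4 + t ^ 2) (fun y ↦ √y * besselMoment t 0 (k * y))
      (fun y ↦ 1 / (2 * √y) * besselMoment t 0 (k * y) - √y * besselMoment t 1 (k * y) * k) where
  hasDerivAt y hy := by
    have hmoment := (hasDerivAt_besselMoment t 0 (mul_pos hk hy)).comp y (hasDerivAt_const_mul k)
    refine ((Real.hasDerivAt_sqrt hy.ne').fun_mul hmoment).congr_deriv ?_
    simp only [Function.comp]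
    ring
  hasDerivAt_deriv y hy := hasDerivAt_deriv_sqrt_mul_besselMoment t hk hy
  tendsto := tendsto_sqrt_mul_besselMoment t 0 hk
  tendsto_deriv := by
    have hlim := ((tendsto_inv_atTop_zero.const_mul (1 / 2)).mul
      (tendsto_sqrt_mul_besselMoment t 0 hk)).sub
      ((tendsto_sqrt_mul_besselMoment t 1 hk).mul_const k)
    simp only [mul_zero, zero_mul, sub_zero] at hlim
    refine hlim.congr fun y ↦ ?_
    have hsqrt : 1 / 2 * y⁻¹ * √y = 1 / (2 * √y) := by
      rw [mul_assoc, inv_mul_eq_div, Real.sqrt_div_self', div_mul_div_comm, one_mul]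
    rw [← mul_assoc, hsqrt]
  pos := by
    filter_upwards [eventually_gt_atTop ((1 + t ^ 2) / k)] with y hy
    have hy0 : 0 < y := lt_trans (by positivity) hy
    rw [div_lt_iff₀' hk] at hy
    exact mul_pos (Real.sqrt_pos.mpr hy0) (besselMoment_zero_pos (by nlinarith [sq_nonneg t]))

end DecayingMode

section ProductIntegral

variable {p S : ℝ} {f g : ℝ → ℝ}

theorem setIntegral_halfCylinder_mul (p S : ℝ) (f g : ℝ → ℝ) :
    ∫ ζ in halfCylinder p S, f ζ.re * g ζ.im =
      (∫ θ in Ioc (-p) p, f θ) * ∫ s in Ioi S, g s := by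
  rw [← integral_Ici_eq_integral_Ioi, ← setIntegral_prod_mul, ← Measure.volume_eq_prod]
  exact Complex.volume_preserving_equiv_real_prod.setIntegral_preimage_emb
    Complex.measurableEquivRealProd.measurableEmbedding (fun x ↦ f x.1 * g x.2)
    (Ioc (-p) p ×ˢ Ici S)

theorem integrableOn_halfCylinder_mul_iff (hf : IntegrableOn f (Ioc (-p) p))
    (hf0 : ∫ θ in Ioc (-p) p, f θ ≠ 0) :
    IntegrableOn (fun ζ ↦ f ζ.re * g ζ.im) (halfCylinder p S) ↔ IntegrableOn g (Ioi S) := by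
  have hprod : IntegrableOn (fun ζ ↦ f ζ.re * g ζ.im) (halfCylinder p S) ↔
      Integrable (fun x : ℝ × ℝ ↦ f x.1 * g x.2)
        ((volume.restrict (Ioc (-p) p)).prod (volume.restrict (Ici S))) := by
    rw [Measure.prod_restrict, ← Measure.volume_eq_prod]
    exact Complex.volume_preserving_equiv_real_prod.integrableOn_comp_preimage
      Complex.measurableEquivRealProd.measurableEmbedding (s := Ioc (-p) p ×ˢ Ici S)
      (f := fun x : ℝ × ℝ ↦ f x.1 * g x.2)
  rw [hprod, ← integrableOn_Ici_iff_integrableOn_Ioi]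
  refine ⟨fun h ↦ ?_, hf.mul_prod⟩
  have hmarginal := h.integral_prod_right
  simp only [integral_mul_const] at hmarginal
  exact (integrable_const_mul_iff hf0.isUnit g).mp hmarginal

end ProductIntegral

section CuspMode

variable {k lam A Y : ℝ} {u v : ℝ → ℝ} {z : ℂ}

/-- The function `u(y) cos (k x)` of `x + i y`. -/
def cosMode (k : ℝ) (u : ℝ → ℝ) (z : ℂ) : ℝ := u z.im * Real.cos (k * z.re)

/-- The function `u(y) cos (2 π x)` on the upper half-plane, of period `1` in `x`. -/
def cuspMode (𝕜 : Type*) [RCLike 𝕜] (u : ℝ → ℝ) (z : ℍ) : 𝕜 := (cosMode (2 * Real.pi) u z : ℝ)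

theorem im_pos_mem_nhds (hz : 0 < z.im) : {w : ℂ | 0 < w.im} ∈ 𝓝 z :=
  (isOpen_lt continuous_const Complex.continuous_im).mem_nhds hz

theorem hasFDerivAt_im_mul_re {f g : ℝ → ℝ} {f' g' : ℝ} (hf : HasDerivAt f f' z.im)
    (hg : HasDerivAt g g' z.re) : HasFDerivAt (fun w : ℂ ↦ f w.im * g w.re)
      ((f' * g z.re) • Complex.imCLM + (f z.im * g') • Complex.reCLM) z := by
  refine ((hf.comp_hasFDerivAt z Complex.imCLM.hasFDerivAt).mul
    (hg.comp_hasFDerivAt z Complex.reCLM.hasFDerivAt)).congr_fderiv ?_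
  ext1 w
  simp
  ring

theorem hasDerivAt_cos_mul (k x : ℝ) :
    HasDerivAt (fun x ↦ Real.cos (k * x)) (-(k * Real.sin (k * x))) x :=
  (hasDerivAt_const_mul k).cos.congr_deriv (by ring)

theorem hasDerivAt_mul_sin_mul (k x : ℝ) :
    HasDerivAt (fun x ↦ -(k * Real.sin (k * x))) (-(k ^ 2 * Real.cos (k * x))) x :=
  ((hasDerivAt_const_mul k).sin.const_mul k).fun_neg.congr_deriv (by ring)

namespace IsDecayingMode

theorem contDiffOn (h : IsDecayingMode k lam u v) : ContDiffOn ℝ 2 u (Ioi 0) := by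
  have hu : DifferentiableOn ℝ u (Ioi 0) := fun y hy ↦
    (h.hasDerivAt y hy).differentiableAt.differentiableWithinAt
  have hv : DifferentiableOn ℝ v (Ioi 0) := fun y hy ↦
    (h.hasDerivAt_deriv y hy).differentiableAt.differentiableWithinAt
  have hcont : ContinuousOn (fun y ↦ (k ^ 2 - lam / y ^ 2) * u y) (Ioi 0) :=
    (continuousOn_const.sub (continuousOn_const.div (by fun_prop) fun y hy ↦
      pow_ne_zero 2 (ne_of_gt hy))).mul hu.continuousOn
  have hvC1 : ContDiffOn ℝ 1 v (Ioi 0) := by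
    rw [← zero_add 1, contDiffOn_succ_iff_deriv_of_isOpen isOpen_Ioi, contDiffOn_zero]
    exact ⟨hv, by simp, hcont.congr fun y hy ↦ (h.hasDerivAt_deriv y hy).deriv⟩
  rw [← one_add_one_eq_two, contDiffOn_succ_iff_deriv_of_isOpen isOpen_Ioi]
  exact ⟨hu, by simp, hvC1.congr fun y hy ↦ (h.hasDerivAt y hy).deriv⟩

theorem contDiffOn_cosMode (h : IsDecayingMode k lam u v) :
    ContDiffOn ℝ 2 (cosMode k u) {z | 0 < z.im} :=
  (h.contDiffOn.comp Complex.imCLM.contDiff.contDiffOn fun _ hz ↦ hz).mul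
    (Real.contDiff_cos.comp (contDiff_const.mul Complex.reCLM.contDiff)).contDiffOn

theorem hasFDerivAt_cosMode (h : IsDecayingMode k lam u v) (hz : 0 < z.im) :
    HasFDerivAt (cosMode k u) ((v z.im * Real.cos (k * z.re)) • Complex.imCLM +
      (u z.im * -(k * Real.sin (k * z.re))) • Complex.reCLM) z :=
  hasFDerivAt_im_mul_re (h.hasDerivAt _ hz) (hasDerivAt_cos_mul k _)

theorem laplacian_cosMode (h : IsDecayingMode k lam u v) (hz : 0 < z.im) :
    Laplacian.laplacian (cosMode k u) z = -(lam / z.im ^ 2 * cosMode k u z) := by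
  have hfderiv : fderiv ℝ (cosMode k u) =ᶠ[𝓝 z] fun z ↦
      (v z.im * Real.cos (k * z.re)) • Complex.imCLM +
        (u z.im * -(k * Real.sin (k * z.re))) • Complex.reCLM := by
    filter_upwards [im_pos_mem_nhds hz] with w hw using (h.hasFDerivAt_cosMode hw).fderiv
  have hsecond := ((hasFDerivAt_im_mul_re (h.hasDerivAt_deriv _ hz)
    (hasDerivAt_cos_mul k _)).smul_const Complex.imCLM).fun_add
    ((hasFDerivAt_im_mul_re (h.hasDerivAt _ hz)
      (hasDerivAt_mul_sin_mul k _)).smul_const Complex.reCLM)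
  rw [laplacian_eq_fderiv_fderiv, hfderiv.fderiv_eq, hsecond.fderiv, cosMode]
  simp
  ring

end IsDecayingMode

variable (𝕜 : Type*) [RCLike 𝕜]

theorem inCoord_cuspMode (u : ℝ → ℝ) (hz : 0 < z.im) :
    inCoord (cuspMode 𝕜 u) z = (cosMode (2 * Real.pi) u z : ℝ) := by
  rw [inCoord, cuspMode, ofComplex_apply_of_im_pos hz]

theorem norm_cuspMode_sq (u : ℝ → ℝ) (z : ℍ) :
    ‖cuspMode 𝕜 u z‖ ^ 2 = Real.cos (2 * Real.pi * z.re) ^ 2 * u z.im ^ 2 := by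
  rw [cuspMode, RCLike.norm_ofReal, sq_abs, cosMode, mul_pow, mul_comm, coe_re, coe_im]

theorem inCoord_cuspMode_eventuallyEq (u : ℝ → ℝ) (hz : 0 < z.im) :
    inCoord (cuspMode 𝕜 u) =ᶠ[𝓝 z] RCLike.ofRealCLM (K := 𝕜) ∘ cosMode (2 * Real.pi) u := by
  filter_upwards [im_pos_mem_nhds hz] with w hw using inCoord_cuspMode 𝕜 u hw

theorem integral_cos_two_pi_sq :
    ∫ θ in (-(1 / 2) : ℝ)..1 / 2, Real.cos (2 * Real.pi * θ) ^ 2 = 1 / 2 := by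
  rw [intervalIntegral.integral_comp_mul_left (fun x ↦ Real.cos x ^ 2) Real.two_pi_pos.ne',
    integral_cos_sq, mul_neg, mul_one_div, mul_div_cancel_left₀ _ two_ne_zero, Real.sin_neg,
    Real.sin_pi, smul_eq_mul]
  field_simp
  ring

theorem setIntegral_cuspMode (hY : 0 < Y) (u G : ℝ → ℝ) :
    (IntegrableOn (fun z ↦ ‖cuspMode 𝕜 u z‖ ^ 2 * G z.im) (cuspStrip Y) ↔
      IntegrableOn (fun y ↦ u y ^ 2 * G y * (y ^ 2)⁻¹) (Ioi Y)) ∧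
      ∫ z in cuspStrip Y, ‖cuspMode 𝕜 u z‖ ^ 2 * G z.im =
        1 / 2 * ∫ y in Ioi Y, u y ^ 2 * G y * (y ^ 2)⁻¹ := by
  have hsep : ∀ z ∈ halfCylinder (1 / 2) Y,
      (z.im ^ 2)⁻¹ * inCoord (fun z ↦ ‖cuspMode 𝕜 u z‖ ^ 2 * G z.im) z =
        Real.cos (2 * Real.pi * z.re) ^ 2 * (u z.im ^ 2 * G z.im * (z.im ^ 2)⁻¹) := fun z hz ↦ by
    lift z to ℍ using hY.trans_le hz.2
    rw [inCoord, ofComplex_apply, norm_cuspMode_sq, coe_re, coe_im]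
    ring
  have hcos : ∫ θ in Ioc (-(1 / 2) : ℝ) (1 / 2), Real.cos (2 * Real.pi * θ) ^ 2 = 1 / 2 := by
    rw [← intervalIntegral.integral_of_le (by norm_num), integral_cos_two_pi_sq]
  have hcosint : IntegrableOn (fun θ ↦ Real.cos (2 * Real.pi * θ) ^ 2) (Ioc (-(1 / 2)) (1 / 2)) :=
    Continuous.integrableOn_Ioc (by fun_prop)
  obtain ⟨hint, heq⟩ := setIntegral_cuspStrip hY fun z ↦ ‖cuspMode 𝕜 u z‖ ^ 2 * G z.im
  rw [hint, heq, integrableOn_congr_fun hsep (measurableSet_halfCylinder _ _),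
    setIntegral_congr_fun (measurableSet_halfCylinder _ _) hsep,
    setIntegral_halfCylinder_mul _ _ (fun θ ↦ Real.cos (2 * Real.pi * θ) ^ 2)
      (fun y ↦ u y ^ 2 * G y * (y ^ 2)⁻¹), hcos]
  exact ⟨integrableOn_halfCylinder_mul_iff (g := fun y ↦ u y ^ 2 * G y * (y ^ 2)⁻¹) hcosint
    (by rw [hcos]; norm_num), rfl⟩

namespace IsDecayingMode

theorem continuous_cuspMode (h : IsDecayingMode (2 * Real.pi) lam u v) :
    Continuous (cuspMode 𝕜 u) :=
  RCLike.continuous_ofReal.comp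
    (h.contDiffOn_cosMode.continuousOn.comp_continuous continuous_coe fun z ↦ z.im_pos)

theorem integrableOn_sq_mul_inv_sq (h : IsDecayingMode k lam u v) (hA : 0 < A) :
    IntegrableOn (fun y ↦ u y ^ 2 * (y ^ 2)⁻¹) (Ioi A) := by
  have hcont : ContinuousOn (fun y ↦ u y ^ 2 * (y ^ 2)⁻¹) (Ici A) := fun y hy ↦ by
    have hy0 : 0 < y := hA.trans_le hy
    exact (((h.hasDerivAt y hy0).continuousAt.pow 2).mul
      ((continuousAt_id.pow 2).inv₀ (pow_ne_zero 2 hy0.ne'))).continuousWithinAt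
  have hbound : (fun y ↦ u y ^ 2 * (y ^ 2)⁻¹) =O[atTop] fun y ↦ 1 * y ^ (-2 : ℝ) :=
    ((h.tendsto.pow 2).isBigO_one ℝ).mul (Asymptotics.isBigO_refl _ _ |>.congr' .rfl <| by
      filter_upwards [eventually_ge_atTop 0] with y hy
      rw [Real.rpow_neg hy, Real.rpow_two])
  rw [← integrableOn_Ici_iff_integrableOn_Ioi]
  refine (hcont.locallyIntegrableOn measurableSet_Ici).integrableOn_of_isBigO_atTop hbound
    ⟨Ioi A, Ioi_mem_atTop A, ?_⟩
  simpa only [one_mul] using integrableOn_Ioi_rpow_of_lt (by norm_num) hA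

theorem isEigenfunctionOn_cuspMode (h : IsDecayingMode (2 * Real.pi) lam u v) (hA : 0 < A) :
    IsEigenfunctionOn (cuspRegion A) lam (cuspMode 𝕜 u) where
  contDiffOn := by
    rw [coe_image_cuspRegion hA]
    exact (RCLike.ofRealCLM (K := 𝕜)).contDiff.comp_contDiffOn
      (h.contDiffOn_cosMode.mono fun z hz ↦ hA.trans_le hz) |>.congr fun z hz ↦
        inCoord_cuspMode 𝕜 u (hA.trans_le hz)
  eigen z _ := by
    have hz : 0 < (z : ℂ).im := z.im_pos
    rw [hypLaplacian, (InnerProductSpace.laplacian_congr_nhds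
        (inCoord_cuspMode_eventuallyEq 𝕜 u hz)).eq_of_nhds,
      (h.contDiffOn_cosMode.contDiffAt (im_pos_mem_nhds hz)).laplacian_CLM_comp_left,
      Function.comp_apply, h.laplacian_cosMode hz, cuspMode, ← map_smul, ← map_neg,
      RCLike.real_smul_eq_coe_mul (K := 𝕜) lam, ← RCLike.ofReal_mul, RCLike.ofRealCLM_apply]
    congr 1
    have him := hz.ne'
    rw [← coe_im, smul_eq_mul]
    field_simp

theorem isCuspEigenfunction (h : IsDecayingMode (2 * Real.pi) lam u v) (hA : 0 < A) :
    IsCuspEigenfunction A lam (cuspMode 𝕜 u) where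
  eigenfunction := h.isEigenfunctionOn_cuspMode 𝕜 hA
  periodic z _ := by
    rw [cuspMode, cuspMode, cosMode, cosMode, coe_im, coe_re, coe_im, coe_re, vadd_im, vadd_re,
      mul_add, mul_one, add_comm, Real.cos_add_two_pi]
  memLp := by
    rw [memLp_two_iff_integrable_sq_norm (h.continuous_cuspMode 𝕜).aestronglyMeasurable]
    have hint := (setIntegral_cuspMode 𝕜 hA u fun _ ↦ 1).1.mpr
      (by simpa only [mul_one] using h.integrableOn_sq_mul_inv_sq hA)
    simpa only [mul_one, IntegrableOn] using hint

theorem isZeroAtImInfty (h : IsDecayingMode k lam u v) : IsZeroAtImInfty (cuspMode 𝕜 u) := by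
  have hlim : Tendsto (fun z : ℍ ↦ ‖u z.im‖) atImInfty (𝓝 0) :=
    tendsto_zero_iff_norm_tendsto_zero.mp (h.tendsto.comp tendsto_comap)
  refine squeeze_zero_norm (fun z ↦ ?_) hlim
  rw [cuspMode, RCLike.norm_ofReal, cosMode, abs_mul]
  exact mul_le_of_le_one_right (abs_nonneg _) (Real.abs_cos_le_one _)

theorem norm_partialDeriv_cuspMode (h : IsDecayingMode (2 * Real.pi) lam u v) (hA : 0 < A)
    (hz : z ∈ closedHalfPlane A) :
    ‖partialDeriv A (inCoord (cuspMode 𝕜 u)) Complex.I z‖ ^ 2 =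
      v z.im ^ 2 * Real.cos (2 * Real.pi * z.re) ^ 2 := by
  have hz0 : 0 < z.im := hA.trans_le hz
  have hderiv := ((RCLike.ofRealCLM (K := 𝕜)).hasFDerivAt.comp z
    (h.hasFDerivAt_cosMode hz0)).congr_of_eventuallyEq (inCoord_cuspMode_eventuallyEq 𝕜 u hz0)
  rw [partialDeriv, hderiv.hasFDerivWithinAt.fderivWithin (uniqueDiffOn_closedHalfPlane A z hz)]
  simp [mul_pow]

theorem restrictedNorm_cuspMode (h : IsDecayingMode (2 * Real.pi) lam u v) (hlam : lam ≠ 0)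
    (hA : 0 < A) (hY : A ≤ Y) :
    restrictedNorm (cuspRegion A) lam (cuspMode 𝕜 u) (horocycle Y (hA.trans_le hY))
      (-(1 / 2)) (1 / 2) = 1 / 2 * (Y⁻¹ * u Y ^ 2 + lam⁻¹ * (Y * v Y ^ 2)) := by
  have hY0 : 0 < Y := hA.trans_le hY
  have hψ := h.isCuspEigenfunction 𝕜 hA
  have hnorm := (isConformalChart_id hA).restrictedNorm_eq hψ.eigenfunction
    (hψ.isCylinderSolution hA) hlam hY (γ := horocycle Y hY0) fun _ ↦ rfl
  have hslice (θ : ℝ) : ‖partialDeriv A (inCoord (cuspMode 𝕜 u)) Complex.I ⟨θ, Y⟩‖ ^ 2 +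
      lam * Y⁻¹ ^ 2 * ‖inCoord (cuspMode 𝕜 u) ⟨θ, Y⟩‖ ^ 2 =
      (v Y ^ 2 + lam * Y⁻¹ ^ 2 * u Y ^ 2) * Real.cos (2 * Real.pi * θ) ^ 2 := by
    rw [h.norm_partialDeriv_cuspMode 𝕜 hA hY, inCoord_cuspMode 𝕜 u hY0, RCLike.norm_ofReal, sq_abs,
      cosMode]
    ring
  simp only [Function.comp_id, slice, hslice, intervalIntegral.integral_const_mul,
    integral_cos_two_pi_sq] at hnorm
  refine mul_left_cancel₀ (mul_ne_zero hlam (inv_ne_zero hY0.ne')) ?_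
  rw [mul_assoc, hnorm]
  field_simp
  ring

end IsDecayingMode

theorem sharpness_horocycle (hA : 0 < A) {α G : ℝ → ℝ} (hG : ContinuousOn G (Ici A))
    (hw : ∀ Y y, A ≤ Y → Y ≤ y → Y * y⁻¹ ≤ α Y * G y)
    (H : ∀ (Y : ℝ) (hY : A ≤ Y) (lam : ℝ), 0 < lam → ∀ ψ : ℍ → 𝕜,
      IsCuspEigenfunction A lam ψ → IsZeroAtImInfty ψ →
        IntegrableOn (fun z ↦ ‖ψ z‖ ^ 2 * G z.im) (cuspStrip Y) ∧
        2 * α Y * (∫ z in cuspStrip Y, ‖ψ z‖ ^ 2 * G z.im) ≤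
          restrictedNorm (cuspRegion A) lam ψ (horocycle Y (hA.trans_le hY)) (-(1 / 2)) (1 / 2))
    {y : ℝ} (hY : A ≤ Y) (hy : Y ≤ y) : α Y * G y = Y * y⁻¹ := by
  by_contra hne
  have hY0 := hA.trans_le hY
  set excess : ℝ → ℝ := fun s ↦ α Y * G s - Y * s⁻¹
  have hpos : 0 < excess y := sub_pos.mpr ((hw Y y hY hy).lt_of_ne' hne)
  have hcont : ContinuousWithinAt excess (Ici y) y :=
    (continuousWithinAt_const.mul
      ((hG y (hY.trans hy)).mono (Ici_subset_Ici.mpr (hY.trans hy)))).sub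
      (continuousWithinAt_const.mul (continuousAt_inv₀ (hY0.trans_le hy).ne').continuousWithinAt)
  obtain ⟨b, hyb, hb⟩ := mem_nhdsGE_iff_exists_Icc_subset.mp
    (hcont.eventually (lt_mem_nhds (half_lt_self hpos)))
  have hlarge : Tendsto (fun t : ℝ ↦ 1 / 4 + t ^ 2) atTop atTop :=
    tendsto_atTop_add_const_left _ _ (tendsto_pow_atTop two_ne_zero)
  obtain ⟨t, ht⟩ := (hlarge.eventually (eventually_forall_lt_mass (2 * Real.pi) hY0 hy hyb
    (half_pos hpos))).exists
  have hmode := isDecayingMode_bessel t Real.two_pi_pos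
  have hlam : 0 < 1 / 4 + t ^ 2 := by positivity
  obtain ⟨hint, hle⟩ := H Y hY _ hlam _ (hmode.isCuspEigenfunction 𝕜 hA) (hmode.isZeroAtImInfty 𝕜)
  rw [(setIntegral_cuspMode 𝕜 hY0 _ G).2, hmode.restrictedNorm_cuspMode 𝕜 hlam.ne' hA hY] at hle
  refine (ht _ _ hmode).not_ge (hmode.weighted_mass_le hlam hY0 hy hyb.le
    ((setIntegral_cuspMode 𝕜 hY0 _ G).1.mp hint) (by linarith) (fun s hs ↦ hw Y s hY hs)
    fun s hs ↦ (hb hs).le)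

end CuspMode

end HypRestriction

end

theorem theorem1p2_general {𝕜 : Type*} [RCLike 𝕜] :
    (∀ (w : ℍ) (R : ℝ), 0 < R → ∀ (lam : ℝ), 0 < lam → ∀ ψ : ℍ → 𝕜,
      HypRestriction.IsEigenfunctionOn (Metric.closedBall w R) lam ψ →
        IntegrableOn (fun z => Real.cosh (dist z w) * ‖ψ z‖ ^ 2) (Metric.closedBall w R) ∧
        2 / Real.sinh R * (∫ z in Metric.closedBall w R, Real.cosh (dist z w) * ‖ψ z‖ ^ 2) ≤
          HypRestriction.restrictedNorm (Metric.closedBall w R) lam ψ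
            (HypRestriction.polar w R) 0 (2 * Real.pi)) ∧
    (∀ (A : ℝ) (hA : 0 < A) (Y : ℝ) (hY : A ≤ Y) (lam : ℝ), 0 < lam → ∀ ψ : ℍ → 𝕜,
      HypRestriction.IsCuspEigenfunction A lam ψ →
        IntegrableOn (fun z => ‖ψ z‖ ^ 2 * z.im⁻¹) (HypRestriction.cuspStrip Y) ∧
        2 * Y * (∫ z in HypRestriction.cuspStrip Y, ‖ψ z‖ ^ 2 * z.im⁻¹) ≤
          HypRestriction.restrictedNorm (HypRestriction.cuspRegion A) lam ψ
            (HypRestriction.horocycle Y (hA.trans_le hY)) (-(1 / 2)) (1 / 2)) ∧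
    (∀ (A : ℝ) (hA : 0 < A) (α G : ℝ → ℝ), ContinuousOn G (Set.Ici A) →
      (∀ Y y, A ≤ Y → Y ≤ y → Y * y⁻¹ ≤ α Y * G y) →
      (∀ (Y : ℝ) (hY : A ≤ Y) (lam : ℝ), 0 < lam → ∀ ψ : ℍ → 𝕜,
        HypRestriction.IsCuspEigenfunction A lam ψ → IsZeroAtImInfty ψ →
          IntegrableOn (fun z => ‖ψ z‖ ^ 2 * G z.im) (HypRestriction.cuspStrip Y) ∧
          2 * α Y * (∫ z in HypRestriction.cuspStrip Y, ‖ψ z‖ ^ 2 * G z.im) ≤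
            HypRestriction.restrictedNorm (HypRestriction.cuspRegion A) lam ψ
              (HypRestriction.horocycle Y (hA.trans_le hY)) (-(1 / 2)) (1 / 2)) →
      ∀ Y y, A ≤ Y → Y ≤ y → α Y * G y = Y * y⁻¹) :=
  ⟨fun w _ hR _ hlam _ hψ ↦ HypRestriction.restriction_circle w hR hlam hψ,
    fun _ hA _ hY _ hlam _ hψ ↦ HypRestriction.restriction_horocycle hA hY hlam hψ,
    fun _ hA _ _ hG hw H _ _ hY hy ↦ HypRestriction.sharpness_horocycle 𝕜 hA hG hw H hY hy⟩

theorem theorem1p2 {𝕜 : Type*} [RCLike 𝕜] :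
    -- hyperbolic circles
    (∀ (w : ℍ) (R : ℝ), 0 < R → ∀ (lam : ℝ), 0 < lam → ∀ ψ : ℍ → 𝕜,
      HypRestriction.IsEigenfunctionOn (Metric.closedBall w R) lam ψ →
        IntegrableOn (fun z => Real.cosh (dist z w) * ‖ψ z‖ ^ 2) (Metric.closedBall w R) ∧
        2 / Real.sinh R * (∫ z in Metric.closedBall w R, Real.cosh (dist z w) * ‖ψ z‖ ^ 2) ≤
          HypRestriction.restrictedNorm (Metric.closedBall w R) lam ψ
            (HypRestriction.polar w R) 0 (2 * Real.pi)) ∧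
    -- closed horocycles
    (∀ (A : ℝ) (hA : 0 < A) (Y : ℝ) (hY : A ≤ Y) (lam : ℝ), 0 < lam → ∀ ψ : ℍ → 𝕜,
      HypRestriction.IsCuspEigenfunction A lam ψ →
        IntegrableOn (fun z => ‖ψ z‖ ^ 2 * z.im⁻¹) (HypRestriction.cuspStrip Y) ∧
        2 * Y * (∫ z in HypRestriction.cuspStrip Y, ‖ψ z‖ ^ 2 * z.im⁻¹) ≤
          HypRestriction.restrictedNorm (HypRestriction.cuspRegion A) lam ψ
            (HypRestriction.horocycle Y (hA.trans_le hY)) (-(1 / 2)) (1 / 2)) ∧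
    -- sharpness of the weight for closed horocycles
    (∀ (A : ℝ) (hA : 0 < A) (α G : ℝ → ℝ),
      ContDiffOn ℝ ∞ α (Set.Ici A) → ContDiffOn ℝ ∞ G (Set.Ici A) →
      (∀ y, A ≤ y → 0 < α y) → (∀ y, A ≤ y → 0 < G y) →
      (∀ Y y, A ≤ Y → Y ≤ y → Y * y⁻¹ ≤ α Y * G y) →
      (∀ (Y : ℝ) (hY : A ≤ Y) (lam : ℝ), 0 < lam → ∀ ψ : ℍ → 𝕜,
        HypRestriction.IsCuspEigenfunction A lam ψ → IsZeroAtImInfty ψ →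
          IntegrableOn (fun z => ‖ψ z‖ ^ 2 * G z.im) (HypRestriction.cuspStrip Y) ∧
          2 * α Y * (∫ z in HypRestriction.cuspStrip Y, ‖ψ z‖ ^ 2 * G z.im) ≤
            HypRestriction.restrictedNorm (HypRestriction.cuspRegion A) lam ψ
              (HypRestriction.horocycle Y (hA.trans_le hY)) (-(1 / 2)) (1 / 2)) →
      ∀ Y y, A ≤ Y → Y ≤ y → α Y * G y = Y * y⁻¹) :=
  ⟨theorem1p2_general.1, theorem1p2_general.2.1, fun A hA α G _ hG _ _ ↦
    theorem1p2_general.2.2 A hA α G hG.continuousOn⟩
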